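/- Let $G$ be a finite group and $k$ a real closed field. A $G$-algebra is a $k$-algebra with an action of $G$ by $k$-algebra automorphisms; $\simeq$ is $G$-equivariant isomorphism of $k$-algebras, and $\mathrm{Aut}_G(A)$ is the group of $G$-equivariant $k$-algebra automorphisms of $A$. A $G$-algebra $A$ is a $G$-Galois algebra if it is faithfully flat over $k$, $A^G=k$, and $A\otimes_k A\to\prod_{g\in G}A$, $x\otimes y\mapsto (x\,(g\cdot y))_g$, is bijective. For a subgroup $S\le G$ and an $S$-algebra $B$, $\mathrm{Ind}_S^G(B)=\{r:G\to B\mid r(sg)=s\cdot r(g)\ \forall s\in S,\,g\in G\}$ with $(g\cdot r)(x)=r(xg)$. Write ${}^gx=gxg^{-1}$. All cochains are normalized (they take the value $1$ as soon as one argument is $1$). For a group $N$, a 2-cocycle $\sigma\in Z^2(N,K^*)$ is a map with $\sigma(x,y)\sigma(xy,z)=\sigma(y,z)\sigma(x,yz)$ (trivial action); it is non-degenerate if $1$ is the only $s\in N$ with $\sigma(s,t)=\sigma(t,s)$ for all $t\in C_N(s)$; and $K_\sigma[N]$ is the twisted group algebra with $K$-basis $(u_x)_{x\in N}$ and $u_xu_y=\sigma(x,y)u_{xy}$.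 A Galois datum for $G$ is $(S,K,N,\sigma,\gamma)$, where $N\trianglelefteq S\le G$; $K/k$ is a Galois extension with a given identification $S/N\cong\mathrm{Gal}(K|k)$, $g\mapsto\bar g$; $\mathrm{char}(k)\nmid|N|$; $\sigma\in Z^2(N,K^*)$ is non-degenerate; and $\gamma:S\times N\to K^*$ satisfies, for $g,h\in S$ and $x,y\in N$, $\bar g(\sigma(x,y))\gamma(g,xy)=\sigma({}^gx,{}^gy)\gamma(g,x)\gamma(g,y)$, $\gamma(gh,x)=\bar g(\gamma(h,x))\gamma(g,{}^hx)$, and $\gamma|_{N\times N}=\gamma_\sigma$ with $\gamma_\sigma(x,y):=\sigma(x,y)\sigma(xy,x^{-1})\sigma(x,x^{-1})^{-1}$. $A(K_\sigma[N],\gamma)$ denotes $K_\sigma[N]$ with the $S$-action $g\cdot(\alpha u_x)=\bar g(\alpha)\gamma(g,x)u_{{}^gx}$. Two such pairs $(\sigma,\gamma)$, $(\sigma',\gamma')$ have the same class in $H^2_S(N,U)$, for an $S$-stable $U\le K^*$ containing their values, if there is $\eta:N\to U$ with $\sigma'(x,y)/\sigma(x,y)=\eta(x)\eta(y)/\eta(xy)$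 and $\gamma'(g,x)/\gamma(g,x)=\bar g(\eta(x))/\eta({}^gx)$. Equality of classes of $\sigma,\sigma'$ in $H^2(N,U)$ means the first of these two equations alone, for some $\eta:N\to U$. For $g\in G$ put $\sigma^g(x,y)=\sigma({}^gx,{}^gy)$ and $\gamma^g(s,x)=\gamma({}^gs,{}^gx)$. A semi-real torsor datum for $G$ is a Galois datum $(S,k(i),N,\sigma,\gamma)$, $i^2=-1$, with a chosen splitting $S=N\oplus\mathrm{Gal}(k(i)|k)$, such that: $S$ is abelian; $k$ has a primitive root of unity of order the exponent of $N$; $\sigma$ has values in $\mu_2=\{\pm1\}$; $\gamma$ is a pairing (multiplicative in each argument) with values in $k^*$, $\gamma|_{\mathrm{Gal}(k(i)|k)\times N}=1$ and $\gamma(x,y)=\sigma(x,y)/\sigma(y,x)$ on $N\times N$; $N$ and $S$ are normal in $G$; $N$ is a 2-group; and for all $g\in G$, $[(\sigma,\gamma)]=[(\sigma^g,\gamma^g)]$ in $H^2_S(N,k(i)^*)$ and in $H^2_S(N,\mu_4)$. A real torsor datum for $G$ is a pair $(N,\sigma)$, where $N$ is a normal elementary abelian 2-subgroup of $G$ and $\sigma\in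 Z^2(N,\mu_2)$ is non-degenerate with $[\sigma]=[\sigma^g]$ in $H^2(N,\mu_2)$ for all $g\in G$; it is regarded as the Galois datum $(S,k,N,\sigma,\gamma)$ with $S=N$ and $\gamma=\gamma_\sigma$. Theorem. Let $A$ be a $G$-Galois algebra over $k$ with $|\mathrm{Aut}_G(A)|=|G|$. Then $A\simeq\mathrm{Ind}_S^G(A(k(i)_\sigma[N],\gamma))$ for a semi-real torsor datum $(S,k(i),N,\sigma,\gamma)$, or $A\simeq\mathrm{Ind}_S^G(A(k_\sigma[N],\gamma))$ for a real torsor datum $(N,\sigma)$, where $S=N$ and $\gamma=\gamma_\sigma$. In either case $N$ is an elementary abelian 2-group. -/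

import Mathlib

noncomputable section

/-! ### `G`-algebras, equivariant automorphisms, Galois algebras -/

/-- The group `Aut_G(A)` of `G`-equivariant `k`-algebra automorphisms of a `G`-algebra `A`. -/
def equivariantAut (k G A : Type*) [CommRing k] [Group G] [Ring A] [Algebra k A]
    [MulSemiringAction G A] : Subgroup (A ≃ₐ[k] A) where
  carrier := {f | ∀ (g : G) (a : A), f (g • a) = g • f a}
  one_mem' := fun _ _ => rfl
  mul_mem' := by
    intro f f' hf hf' g a
    change f (f' (g • a)) = g • f (f' a)
    rw [hf', hf]
  inv_mem' := by
    intro f hf g a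
    change f.symm (g • a) = g • f.symm a
    apply f.injective
    rw [hf, f.apply_symm_apply, f.apply_symm_apply]

/-- Two `G`-algebras over `k` are isomorphic: there is a `G`-equivariant isomorphism of
`k`-algebras between them. -/
def GAlgIsomorphic (k G A B : Type*) [CommRing k] [Group G] [Ring A] [Algebra k A]
    [MulSemiringAction G A] [Ring B] [Algebra k B] [MulSemiringAction G B] : Prop :=
  ∃ f : A ≃ₐ[k] B, ∀ (g : G) (a : A), f (g • a) = g • f a

/-- The canonical map `A ⊗ A → A ⊗ 𝒪(G)`, `x ⊗ y ↦ ∑ g, x (g • y) ⊗ δ_g`, where `A ⊗ 𝒪(G)` is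
identified with the functions `G → A` (for a finite group `G`). -/
def galoisCanMap (k G A : Type*) [CommRing k] [Group G] [Ring A] [Algebra k A]
    [MulSemiringAction G A] [SMulCommClass G k A] : TensorProduct k A A →ₗ[k] (G → A) :=
  TensorProduct.lift (LinearMap.mk₂ k (fun x y g => x * g • y)
    (by intro x x' y; funext g; simp [add_mul])
    (by intro c x y; funext g; simp)
    (by intro x y y'; funext g; simp [mul_add])
    (by intro c x y; funext g; simp [smul_comm g c y]))

/-- A `G`-algebra `A` over `k` is a `G`-Galois algebra, i.e. a Galois object for the Hopf algebra
`𝒪_k(G)` of functions on the finite group `G`. -/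
structure IsGaloisAlgebra (k G A : Type*) [CommRing k] [Group G] [Ring A] [Algebra k A]
    [MulSemiringAction G A] [SMulCommClass G k A] : Prop where
  faithfullyFlat : Module.FaithfullyFlat k A
  /-- the invariants are `k` -/
  invariants : ∀ a : A, (∀ g : G, g • a = a) ↔ a ∈ (algebraMap k A).range
  can_bijective : Function.Bijective (galoisCanMap k G A)

/-! ### Induced algebras -/

section Induced

variable (k : Type*) {G : Type*} [CommRing k] [Group G] (S : Subgroup G)
  (B : Type*) [Ring B] [Algebra k B] [MulSemiringAction S B] [SMulCommClass S k B]

/-- `Ind_S^G(B) = {r : G → B | r (s g) = s • r g}`. -/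
def inducedAlgebra : Subalgebra k (G → B) where
  carrier := {r | ∀ (s : S) (g : G), r (s * g) = s • r g}
  mul_mem' := by intro a b ha hb s g; simp [ha s g, hb s g, smul_mul']
  add_mem' := by intro a b ha hb s g; simp [ha s g, hb s g]
  algebraMap_mem' := by intro c s g; simp [Pi.algebraMap_apply, smul_algebraMap]

/-- The `G`-action `(g • r) x = r (x g)` on `Ind_S^G(B)`. -/
instance inducedAlgebra.instMulSemiringAction : MulSemiringAction G (inducedAlgebra k S B) where
  smul g r := ⟨fun x => r.1 (x * g), fun s x => by
    change r.1 (s * x * g) = s • r.1 (x * g)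
    rw [mul_assoc]; exact r.2 s (x * g)⟩
  one_smul r := Subtype.ext (funext fun x => congrArg r.1 (mul_one x))
  mul_smul g h r := Subtype.ext (funext fun x => congrArg r.1 (mul_assoc x g h).symm)
  smul_zero _ := rfl
  smul_add _ _ _ := rfl
  smul_one _ := rfl
  smul_mul _ _ _ := rfl

end Induced

/-! ### Two-cocycles and twisted group algebras -/

/-- Normalized 2-cocycles of `N` with values in the abelian group `M`, with trivial action. -/
structure TwoCocycle (N M : Type*) [Group N] [CommGroup M] where
  toFun : N → N → M
  one_left : ∀ x, toFun 1 x = 1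
  one_right : ∀ x, toFun x 1 = 1
  cocycle : ∀ x y z, toFun x y * toFun (x * y) z = toFun y z * toFun x (y * z)

namespace TwoCocycle

variable {N M : Type*} [Group N] [CommGroup M] (σ : TwoCocycle N M)

instance : CoeFun (TwoCocycle N M) (fun _ => N → N → M) := ⟨toFun⟩

/-- `s` is `σ`-regular if `σ(s,t) = σ(t,s)` for every `t` in the centralizer of `s`. -/
def IsRegular (s : N) : Prop := ∀ t : N, Commute s t → σ s t = σ t s

/-- `σ` is non-degenerate if `1` is the only `σ`-regular element. -/
def IsNondegenerate : Prop := ∀ s : N, σ.IsRegular s → s = 1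

/-- `γ_σ(x,y) = σ(x,y) σ(xy,x⁻¹) σ(x,x⁻¹)⁻¹`. -/
def inner (x y : N) : M := σ x y * σ (x * y) x⁻¹ * (σ x x⁻¹)⁻¹

/-- `Alt(σ)(x,y) = σ(x,y) / σ(y,x)`. -/
def alt (x y : N) : M := σ x y / σ y x

end TwoCocycle

/-- The twisted group algebra `K_σ[N]`: the `K`-vector space with basis `u_x`, `x ∈ N`, and
multiplication `(α u_x) (β u_y) = α β σ(x,y) u_{xy}`. -/
def TwistedGroupAlgebra {N K : Type*} [Group N] [Field K] (_σ : TwoCocycle N Kˣ) : Type _ := N →₀ K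

namespace TwistedGroupAlgebra

variable {N K : Type*} [Group N] [Field K] (σ : TwoCocycle N Kˣ)

instance : AddCommGroup (TwistedGroupAlgebra σ) := inferInstanceAs (AddCommGroup (N →₀ K))

/-- The element `α u_x`. -/
def single (x : N) : K →+ TwistedGroupAlgebra σ := Finsupp.singleAddHom x

theorem induction {σ : TwoCocycle N Kˣ} {p : TwistedGroupAlgebra σ → Prop}
    (a : TwistedGroupAlgebra σ) (zero : p 0) (add : ∀ a b, p a → p b → p (a + b))
    (single : ∀ x α, p (single σ x α)) : p a :=
  Finsupp.induction_linear (motive := p) a zero add single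

instance : Mul (TwistedGroupAlgebra σ) :=
  ⟨fun a b => Finsupp.sum (M := K) a fun x α => Finsupp.sum (M := K) b fun y β =>
    single σ (x * y) (α * β * σ x y)⟩

instance : One (TwistedGroupAlgebra σ) := ⟨single σ 1 1⟩

theorem mul_def (a b : TwistedGroupAlgebra σ) :
    a * b = Finsupp.sum (M := K) a fun x α => Finsupp.sum (M := K) b fun y β =>
      single σ (x * y) (α * β * σ x y) := rfl

theorem one_def : (1 : TwistedGroupAlgebra σ) = single σ 1 1 := rfl

theorem single_mul_single (x y : N) (α β : K) :
    single σ x α * single σ y β = single σ (x * y) (α * β * σ x y) :=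
  (Finsupp.sum_single_index (by simp [Finsupp.sum])).trans (Finsupp.sum_single_index (by simp))

theorem add_mul_aux (a b c : TwistedGroupAlgebra σ) : (a + b) * c = a * c + b * c :=
  Finsupp.sum_add_index' (by simp [Finsupp.sum])
    (by intro x α α'; simp [Finsupp.sum, add_mul, Finset.sum_add_distrib])

theorem mul_add_aux (a b c : TwistedGroupAlgebra σ) : a * (b + c) = a * b + a * c := by
  simp only [mul_def]
  refine Eq.trans ?_ Finsupp.sum_add
  refine congrArg (Finsupp.sum (M := K) a) (funext fun x => funext fun α => ?_)
  exact Finsupp.sum_add_index' (by simp) (by intro y β β'; simp [mul_add, add_mul])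

theorem zero_mul_aux (a : TwistedGroupAlgebra σ) : 0 * a = 0 := Finsupp.sum_zero_index

theorem mul_zero_aux (a : TwistedGroupAlgebra σ) : a * 0 = 0 := by
  have h := mul_add_aux σ a 0 0
  rw [add_zero] at h
  exact left_eq_add.mp h

instance : Ring (TwistedGroupAlgebra σ) :=
  { (inferInstance : AddCommGroup (TwistedGroupAlgebra σ)) with
    left_distrib := mul_add_aux σ
    right_distrib := add_mul_aux σ
    zero_mul := zero_mul_aux σ
    mul_zero := mul_zero_aux σ
    one_mul := fun a => by
      induction a using induction with
      | zero => exact mul_zero_aux σ 1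
      | add a b ha hb => rw [mul_add_aux, ha, hb]
      | single x α => simp [one_def, single_mul_single, σ.one_left]
    mul_one := fun a => by
      induction a using induction with
      | zero => exact zero_mul_aux σ 1
      | add a b ha hb => rw [add_mul_aux, ha, hb]
      | single x α => simp [one_def, single_mul_single, σ.one_right]
    mul_assoc := fun a b c => by
      induction a using induction with
      | zero => simp only [zero_mul_aux]
      | add a a' ha ha' => simp only [add_mul_aux, ha, ha']
      | single x α =>
        induction b using induction with
        | zero => simp only [zero_mul_aux, mul_zero_aux]
        | add b b' hb hb' => simp only [add_mul_aux, mul_add_aux, hb, hb']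
        | single y β =>
          induction c using induction with
          | zero => simp only [mul_zero_aux]
          | add c c' hc hc' => simp only [mul_add_aux, hc, hc']
          | single z δ =>
            have h : (σ x y : K) * σ (x * y) z = σ y z * σ x (y * z) := by
              exact_mod_cast congrArg Units.val (σ.cocycle x y z)
            simp only [single_mul_single, mul_assoc x y z]
            congr 1
            linear_combination (α * β * δ) * h }

instance (R : Type*) [CommRing R] [Algebra R K] : Module R (TwistedGroupAlgebra σ) :=
  inferInstanceAs (Module R (N →₀ K))

theorem smul_single {R : Type*} [CommRing R] [Algebra R K] (r : R) (x : N) (α : K) :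
    r • single σ x α = single σ x (r • α) :=
  Finsupp.smul_single r x α

/-- `K_σ[N]` is an algebra over every ring `R` over which `K` is an algebra. -/
instance (R : Type*) [CommRing R] [Algebra R K] : Algebra R (TwistedGroupAlgebra σ) :=
  Algebra.ofModule
    (fun r a b => by
      induction a using induction with
      | zero => simp
      | add a a' ha ha' => simp only [smul_add, add_mul, ha, ha']
      | single x α =>
        induction b using induction with
        | zero => simp
        | add b b' hb hb' => simp only [smul_add, mul_add, hb, hb']
        | single y β => simp [smul_single, single_mul_single])
    (fun r a b => by
      induction a using induction with
      | zero => simp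
      | add a a' ha ha' => simp only [smul_add, add_mul, ha, ha']
      | single x α =>
        induction b using induction with
        | zero => simp
        | add b b' hb hb' => simp only [smul_add, mul_add, hb, hb']
        | single y β => simp [smul_single, single_mul_single])

end TwistedGroupAlgebra

/-! ### Galois data -/

/-- The conjugate `ᵍx = g x g⁻¹` as an element of a subgroup `N` stable under conjugation
by `g`. -/
def conjIn {G : Type*} [Group G] (N : Subgroup G) (g : G) (hg : ∀ x ∈ N, g * x * g⁻¹ ∈ N)
    (x : N) : N := ⟨g * x * g⁻¹, hg x x.2⟩

/-- A Galois datum `(S, K, N, σ, γ)` associated to `G`, over the field `k`. The field `toGal`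
with its two properties is the identification of `S/N` with `Gal(K|k)`; the pair `(σ, γ)` is a
2-cocycle in `Z²_S(N, Kˣ)` such that `γ = γ_σ` on `N × N`. -/
structure GaloisDatum (k K G : Type*) [Field k] [Field K] [Algebra k K] [Group G] where
  S : Subgroup G
  N : Subgroup G
  N_le : N ≤ S
  conj_mem : ∀ g ∈ S, ∀ x ∈ N, g * x * g⁻¹ ∈ N
  isGalois : IsGalois k K
  toGal : S →* (K ≃ₐ[k] K)
  toGal_surjective : Function.Surjective toGal
  toGal_ker : toGal.ker = N.subgroupOf S
  not_char_dvd : ¬ ringChar k ∣ Nat.card N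
  σ : TwoCocycle N Kˣ
  nondegenerate : σ.IsNondegenerate
  γ : S → N → Kˣ
  γ_one_left : ∀ x, γ 1 x = 1
  γ_one_right : ∀ g, γ g 1 = 1
  γ_mul_right : ∀ (g : S) (x y : N), toGal g (σ x y : K) * γ g (x * y) =
    σ (conjIn N g (conj_mem g g.2) x) (conjIn N g (conj_mem g g.2) y) * γ g x * γ g y
  γ_mul_left : ∀ (g h : S) (x : N), (γ (g * h) x : K) =
    toGal g (γ h x : K) * γ g (conjIn N h (conj_mem h h.2) x)
  γ_eq_inner : ∀ x y : N, γ (Subgroup.inclusion N_le x) y = σ.inner x y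

namespace GaloisDatum

variable {k K G : Type*} [Field k] [Field K] [Algebra k K] [Group G] (D : GaloisDatum k K G)

/-- The conjugation action of `S` on `N`. -/
def conjS (g : D.S) (x : D.N) : D.N := conjIn D.N g (D.conj_mem g g.2) x

/-- The pair `(σ', γ')` and the pair `(σ, γ)` of the datum have the same class with coefficients
in the subgroup `U` of `Kˣ`: they differ by the coboundary of a normalized 1-cochain `η : N → U`.
For `U = Kˣ` this is equality in `H²_S(N, Kˣ)`, for `U = μ₄` (and pairs with values in `μ₄`)
equality in `H²_S(N, μ₄)`. -/
def CohomologousIn (U : Subgroup Kˣ) (σ' : D.N → D.N → Kˣ) (γ' : D.S → D.N → Kˣ) : Prop :=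
  ∃ η : D.N → Kˣ, (∀ x, η x ∈ U) ∧ η 1 = 1 ∧
    (∀ x y, σ' x y = D.σ x y * (η y * η x / η (x * y))) ∧
    (∀ g x, (γ' g x : K) = D.γ g x * (D.toGal g (η x : K) / η (D.conjS g x)))

/-- The algebra `A(K_σ[N], γ)`: the twisted group algebra `K_σ[N]`, with the `S`-action given
below. -/
def Alg : Type _ := TwistedGroupAlgebra D.σ

instance : Ring D.Alg := inferInstanceAs (Ring (TwistedGroupAlgebra D.σ))

instance : Algebra k D.Alg := inferInstanceAs (Algebra k (TwistedGroupAlgebra D.σ))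

/-- The element `α u_x`. -/
def single (x : D.N) : K →+ D.Alg := TwistedGroupAlgebra.single D.σ x

theorem Alg.induction {D : GaloisDatum k K G} {p : D.Alg → Prop}
    (a : D.Alg) (zero : p 0) (add : ∀ a b, p a → p b → p (a + b))
    (single : ∀ x α, p (D.single x α)) : p a :=
  TwistedGroupAlgebra.induction a zero add single

/-- `g • (α u_x) = ḡ(α) γ(g,x) u_{ᵍx}`. -/
def act (g : D.S) : D.Alg →+ D.Alg :=
  Finsupp.liftAddHom (M := K) fun x =>
    (D.single (D.conjS g x)).comp
      ((AddMonoidHom.mulRight (D.γ g x : K)).comp (D.toGal g : K →+* K).toAddMonoidHom)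

theorem act_single (g : D.S) (x : D.N) (α : K) :
    D.act g (D.single x α) = D.single (D.conjS g x) (D.toGal g α * D.γ g x) :=
  Finsupp.liftAddHom_apply_single (M := K) _ x α

theorem single_mul_single (x y : D.N) (α β : K) :
    D.single x α * D.single y β = D.single (x * y) (α * β * D.σ x y) :=
  TwistedGroupAlgebra.single_mul_single D.σ x y α β

theorem smul_single (r : k) (x : D.N) (α : K) : r • D.single x α = D.single x (r • α) :=
  TwistedGroupAlgebra.smul_single D.σ r x α

theorem conjS_one_right (g : D.S) : D.conjS g 1 = 1 := Subtype.ext (by simp [conjS, conjIn])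

theorem conjS_mul_right (g : D.S) (x y : D.N) :
    D.conjS g (x * y) = D.conjS g x * D.conjS g y :=
  Subtype.ext (by simp [conjS, conjIn])

theorem conjS_one_left (x : D.N) : D.conjS 1 x = x := Subtype.ext (by simp [conjS, conjIn])

theorem conjS_mul_left (g h : D.S) (x : D.N) : D.conjS (g * h) x = D.conjS g (D.conjS h x) :=
  Subtype.ext (by simp [conjS, conjIn, mul_assoc])

instance : MulSemiringAction D.S D.Alg where
  smul g a := D.act g a
  one_smul a := by
    change D.act 1 a = a
    induction a using Alg.induction with
    | zero => simp
    | add a b ha hb => rw [map_add, ha, hb]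
    | single x α => simp [act_single, conjS_one_left, D.γ_one_left]
  mul_smul g h a := by
    change D.act (g * h) a = D.act g (D.act h a)
    induction a using Alg.induction with
    | zero => simp
    | add a b ha hb => simp only [map_add, ha, hb]
    | single x α =>
      simp only [act_single, conjS_mul_left, map_mul, AlgEquiv.mul_apply]
      rw [D.γ_mul_left, mul_assoc]
      rfl
  smul_zero g := map_zero (D.act g)
  smul_add g a b := map_add (D.act g) a b
  smul_one g := by
    change D.act g (D.single 1 1) = D.single 1 1
    simp [act_single, conjS_one_right, D.γ_one_right]
  smul_mul g a b := by
    change D.act g (a * b) = D.act g a * D.act g b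
    induction a using Alg.induction with
    | zero => simp
    | add a a' ha ha' => simp only [map_add, add_mul, ha, ha']
    | single x α =>
      induction b using Alg.induction with
      | zero => simp
      | add b b' hb hb' => simp only [map_add, mul_add, hb, hb']
      | single y β =>
        simp only [act_single, single_mul_single, conjS_mul_right, map_mul]
        congr 1
        have h := D.γ_mul_right g x y
        change D.toGal g (D.σ x y : K) * D.γ g (x * y) =
          D.σ (D.conjS g x) (D.conjS g y) * D.γ g x * D.γ g y at h
        linear_combination (D.toGal g α * D.toGal g β) * h

instance : SMulCommClass D.S k D.Alg where
  smul_comm g r a := by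
    change D.act g (r • a) = r • D.act g a
    induction a using Alg.induction with
    | zero => simp
    | add a b ha hb => simp only [smul_add, map_add, ha, hb]
    | single x α => simp [act_single, smul_single]

/-- The induced `G`-algebra `Ind_S^G(A(K_σ[N], γ))`. -/
abbrev Ind : Subalgebra k (G → D.Alg) := inducedAlgebra k D.S D.Alg

end GaloisDatum

/-! ### Torsor data -/

/-- A torsor datum: a Galois datum `(S, K, N, σ, γ)` with a splitting `S = N ⊕ Gal(K|k)` and the
properties below. -/
structure TorsorDatum (k K G : Type*) [Field k] [Field K] [Algebra k K] [Group G]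
    extends GaloisDatum k K G where
  S_comm : ∀ s ∈ S, ∀ t ∈ S, s * t = t * s
  /-- the splitting -/
  sec : (K ≃ₐ[k] K) →* S
  toGal_sec : ∀ ω, toGal (sec ω) = ω
  exists_primitiveRoot : ∃ ζ : k, IsPrimitiveRoot ζ (Monoid.exponent N)
  σ_mem : ∀ x y, σ x y ∈ (Units.map (algebraMap k K : k →* K)).range
  γ_mem : ∀ s x, γ s x ∈ (Units.map (algebraMap k K : k →* K)).range
  γ_pairing_left : ∀ s t x, γ (s * t) x = γ s x * γ t x
  γ_pairing_right : ∀ s x y, γ s (x * y) = γ s x * γ s y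
  γ_sec : ∀ ω x, γ (sec ω) x = 1
  γ_alt : ∀ x y : N, γ (Subgroup.inclusion N_le x) y = σ.alt x y
  N_normal : N.Normal
  S_normal : S.Normal
  /-- `[(σ, γ)] = [(σᵍ, γᵍ)]` in `H²_S(N, Kˣ)` -/
  cohomologous : ∀ g : G, toGaloisDatum.CohomologousIn ⊤
    (fun x y => σ (conjIn N g (fun n hn => N_normal.conj_mem n hn g) x)
      (conjIn N g (fun n hn => N_normal.conj_mem n hn g) y))
    (fun s x => γ (conjIn S g (fun n hn => S_normal.conj_mem n hn g) s)
      (conjIn N g (fun n hn => N_normal.conj_mem n hn g) x))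

/-- The field `k(i)`, `i² = -1`. -/
abbrev AdjoinI (k : Type*) [Field k] : Type _ :=
  (Polynomial.X ^ 2 + 1 : Polynomial k).SplittingField

/-- A semi-real torsor datum for `G`: a torsor datum `(S, k(i), N, σ, γ)` such that `N` is an
(abelian) 2-group, `σ` has values in `μ₂ = ⟨-1⟩`, and `[(σ, γ)] = [(σᵍ, γᵍ)]` in `H²_S(N, μ₄)`. -/
structure SemiRealTorsorDatum (k G : Type*) [Field k] [Group G]
    extends TorsorDatum k (AdjoinI k) G where
  isPGroup : IsPGroup 2 N
  σ_mem_two : ∀ x y, σ x y ∈ Subgroup.zpowers (-1 : (AdjoinI k)ˣ)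
  cohomologous_four : ∀ g : G, toGaloisDatum.CohomologousIn (rootsOfUnity 4 (AdjoinI k))
    (fun x y => σ (conjIn N g (fun n hn => N_normal.conj_mem n hn g) x)
      (conjIn N g (fun n hn => N_normal.conj_mem n hn g) y))
    (fun s x => γ (conjIn S g (fun n hn => S_normal.conj_mem n hn g) s)
      (conjIn N g (fun n hn => N_normal.conj_mem n hn g) x))

/-- `N` is an elementary abelian 2-group. -/
structure IsElementaryAbelianTwo {G : Type*} [Group G] (N : Subgroup G) : Prop where
  comm : ∀ x ∈ N, ∀ y ∈ N, x * y = y * x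
  sq_eq_one : ∀ x ∈ N, x ^ 2 = 1

/-- A real torsor datum `(N, σ)` for `G`: `N` is a normal elementary abelian 2-subgroup,
`σ ∈ Z²(N, μ₂)` is non-degenerate and `[σ] = [σᵍ]` in `H²(N, μ₂)` for all `g`, where
`μ₂ = ⟨-1⟩ ⊆ kˣ`. -/
structure RealTorsorDatum (k G : Type*) [Field k] [Group G] where
  N : Subgroup G
  N_normal : N.Normal
  elementary : IsElementaryAbelianTwo N
  σ : TwoCocycle N kˣ
  σ_mem_two : ∀ x y, σ x y ∈ Subgroup.zpowers (-1 : kˣ)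
  nondegenerate : σ.IsNondegenerate
  cohomologous : ∀ g : G, ∃ η : N → kˣ,
    (∀ x, η x ∈ Subgroup.zpowers (-1 : kˣ)) ∧ η 1 = 1 ∧
    ∀ x y, σ (conjIn N g (fun n hn => N_normal.conj_mem n hn g) x)
      (conjIn N g (fun n hn => N_normal.conj_mem n hn g) y) =
        σ x y * (η y * η x / η (x * y))

namespace TwoCocycle

variable {N M : Type*} [Group N] [CommGroup M] (σ : TwoCocycle N M)

theorem inner_eq_alt (hN : ∀ x y : N, x * y = y * x) (x y : N) : σ.inner x y = σ.alt x y := by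
  have h := σ.cocycle y x x⁻¹
  rw [mul_inv_cancel, σ.one_right, mul_one] at h
  rw [inner, alt, hN x y, ← h, mul_inv, div_eq_mul_inv]
  rw [mul_assoc, mul_comm (σ y x)⁻¹, mul_inv_cancel_left]

theorem alt_mul_left (hN : ∀ x y : N, x * y = y * x) (x y z : N) :
    σ.alt (x * y) z = σ.alt x z * σ.alt y z := by
  have h1 := σ.cocycle x y z
  have h2 := σ.cocycle x z y
  have h3 := σ.cocycle z x y
  rw [hN z y] at h2
  rw [hN z x] at h3
  have e1 : σ (x * y) z = σ y z * σ x (y * z) / σ x y := by rw [← h1]; simp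
  have e2 : σ z (x * y) = σ z x * σ (x * z) y / σ x y := by rw [h3]; simp
  have e3 : σ (x * z) y = σ z y * σ x (y * z) / σ x z := by rw [← h2]; simp
  simp only [alt, e1, e2, e3, div_eq_mul_inv, mul_inv, inv_inv]
  apply Additive.ofMul.injective
  simp only [ofMul_mul, ofMul_inv]
  abel

theorem alt_symm (x y : N) : σ.alt x y = (σ.alt y x)⁻¹ := by simp [alt]

theorem alt_mul_right (hN : ∀ x y : N, x * y = y * x) (x y z : N) :
    σ.alt x (y * z) = σ.alt x y * σ.alt x z := by
  rw [alt_symm, alt_mul_left σ hN, mul_inv, ← alt_symm, ← alt_symm]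

end TwoCocycle

/-- A real torsor datum `(N, σ)` over a formally real field, regarded as the Galois datum
`(N, k, N, σ, γ_σ)`. -/
def RealTorsorDatum.toGaloisDatum {k G : Type*} [Field k] [IsSemireal k] [Group G] [Finite G]
    (D : RealTorsorDatum k G) : GaloisDatum k k G :=
  have hc : ∀ x y : D.N, x * y = y * x := fun x y =>
    Subtype.ext (D.elementary.comm x x.2 y y.2)
  have hconj : ∀ (g x : D.N) (h : ∀ n ∈ D.N, (g : G) * n * (g : G)⁻¹ ∈ D.N),
      conjIn D.N g h x = x := fun g x _ => by
    apply Subtype.ext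
    change (g : G) * x * (g : G)⁻¹ = x
    rw [D.elementary.comm g g.2 x x.2, mul_inv_cancel_right]
  { S := D.N
    N := D.N
    N_le := le_rfl
    conj_mem := fun g hg x hx => D.N.mul_mem (D.N.mul_mem hg hx) (D.N.inv_mem hg)
    isGalois := inferInstance
    toGal := 1
    toGal_surjective := fun _ => ⟨1, Subsingleton.elim _ _⟩
    toGal_ker := by simp
    not_char_dvd := by
      rw [ringChar.eq_zero, zero_dvd_iff]
      exact Nat.card_pos.ne'
    σ := D.σ
    nondegenerate := D.nondegenerate
    γ := D.σ.inner
    γ_one_left := fun x => by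
      simp [D.σ.inner_eq_alt hc, TwoCocycle.alt, D.σ.one_left, D.σ.one_right]
    γ_one_right := fun x => by
      simp [D.σ.inner_eq_alt hc, TwoCocycle.alt, D.σ.one_left, D.σ.one_right]
    γ_mul_right := fun g x y => by
      simp only [hconj, D.σ.inner_eq_alt hc, D.σ.alt_mul_right hc]
      simp [mul_assoc]
    γ_mul_left := fun g h x => by
      simp only [hconj, D.σ.inner_eq_alt hc, D.σ.alt_mul_left hc]
      simp [mul_comm]
    γ_eq_inner := fun _ _ => rfl }

end

noncomputable section

/-! ### Real closed fields -/

/-! Let `M` be a maximal two-sided ideal of `A`, `S` its stabilizer and `B = A ⧸ M`. A Galois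
algebra has no proper nonzero `G`-stable two-sided ideal, so the Chinese remainder theorem along the
orbit of `M` identifies `A` with the algebra induced from `B`, and `B` is a simple `S`-Galois
algebra. Its center `K` is finite over `k`, hence `k` or `k(i)`.

Bijectivity of the canonical map says that every `k`-linear endomorphism of `B` is uniquely of the
form `y ↦ ∑ (s • y) b_s`. For left multiplications this splits `B` into spaces of conjugators, the
`u` with `(s • z) u = u z`. By simplicity a nonzero conjugator is a unit and each space is at most a
line over `K`; a dimension count shows that it is a line exactly when `s` lies in the kernel `N` of
`S → Gal(K|k)`. Hence conjugators `u_x`, `x ∈ N`, form a `K`-basis, and `B = K_σ[N]`.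

An equivariant automorphism of `B` trivial on `K` multiplies each `u_x` by the value of a character
of `N`, so `|Aut_S(B)| ≤ |N| |Gal(K|k)| = |S|`. The group `Aut_G(A)` moves `M` inside its `G`-orbit,
and the stabilizer of `M` in it embeds into `Aut_S(B)`. Thus `|Aut_G(A)| = |G|` forces equality
everywhere (`stabilizer_of_card_equivariantAut`, `of_card_le_card_equivariantAut`): `S` is normal,
the action of `S` on `B` is isomorphic to its conjugates, the equivariant characters separate the
points of `N`, and every automorphism of `K` lifts to `Aut_S(B)`.

The rest is positivity: a root of unity in `k` is a sign, and a norm from `k(i)` that is a root of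
unity is `1`. Over `k` the characters are signs, so `N` has exponent two. Over `k(i)` a lift of
complex conjugation shows that `N` acts on the `u_x` by real roots of unity, again signs; and an
element `g` of `S` inducing complex conjugation is central of order two, which splits `S`
(`elementary_of_card_le`, `mul_self_eq_one`). Real square roots, together with Hilbert 90 over
`k(i)`, normalize `u_x ^ 2 = ±1` with `u_x` fixed by `g`. Then `σ` is real with `σ ^ 2 = ±1`, hence
a sign. The cochains `η` comparing conjugate cocycles only satisfy `η ^ 2 = ±1`, which gives `μ₂`
over `k` and `μ₄` over `k(i)`. -/

theorem IsSumSq.pow {k : Type*} [CommSemiring k] {x : k} (hx : IsSumSq x) (n : ℕ) :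
    IsSumSq (x ^ n) := by
  induction n with
  | zero => simp
  | succ n ih => rw [pow_succ]; exact ih.mul hx

/-- The geometric sum dividing `x ^ n - 1` is `1` plus a sum of squares, hence nonzero in a formally
real field. This is the positivity argument behind every later reduction of a root of unity to a
sign. -/
theorem IsSumSq.eq_one_of_pow_eq_one {k : Type*} [Field k] [IsSemireal k] {x : k}
    (hx : IsSumSq x) {n : ℕ} (hn : n ≠ 0) (h : x ^ n = 1) : x = 1 := by
  obtain ⟨m, rfl⟩ := Nat.exists_eq_succ_of_ne_zero hn
  have h1 : (∑ i ∈ Finset.range (m + 1), x ^ i) * (x - 1) = 0 := by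
    rw [geom_sum_mul, h, sub_self]
  rcases mul_eq_zero.mp h1 with h2 | h2
  · rw [Finset.sum_range_succ', pow_zero, add_comm] at h2
    exact absurd h2 (IsSemireal.one_add_ne_zero (IsSumSq.sum fun i _ => hx.pow _))
  · exact sub_eq_zero.mp h2

theorem sq_eq_one_of_pow_eq_one {k : Type*} [Field k] [IsSemireal k] {x : k}
    {n : ℕ} (hn : n ≠ 0) (h : x ^ n = 1) : x ^ 2 = 1 := by
  refine IsSumSq.eq_one_of_pow_eq_one (x := x ^ 2) ?_ hn (by rw [pow_right_comm, h, one_pow])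
  rw [sq]
  exact IsSumSq.mul_self x

theorem sq_ne_neg_one {k : Type*} [Field k] [IsSemireal k] (x : k) : x ^ 2 ≠ -1 := fun h =>
  IsSemireal.one_add_ne_zero (IsSumSq.mul_self x) (by rw [← sq, h]; ring)

theorem IsSemireal.eq_zero_of_sq_add_eq_zero {k : Type*} [Field k] [IsSemireal k] {x s : k}
    (hs : IsSumSq s) (h : x ^ 2 + s = 0) : x = 0 := by
  by_contra hx
  refine IsSemireal.one_add_ne_zero (R := k) (s := s * (x⁻¹ * x⁻¹)) (hs.mul (IsSumSq.mul_self _)) ?_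
  have h2 : x ^ 2 ≠ 0 := pow_ne_zero 2 hx
  have h3 : 1 + s * (x⁻¹ * x⁻¹) = (x ^ 2 + s) * (x ^ 2)⁻¹ := by field_simp
  rw [h3, h, zero_mul]

namespace IsRealClosed

/-! ### Arithmetic and square roots in `k(i)` -/

section Gaussian

variable {k E : Type*} [Field k] [Field E] [Algebra k E]

variable (k) in
/-- The elements `x + y i` with `x` and `y` in `k`. -/
def gaussian (i : E) : Set E := {z | ∃ x y : k, z = algebraMap k E x + algebraMap k E y * i}

theorem gaussian_mul {i : E} (hi : i ^ 2 = -1) {z w : E} (hz : z ∈ gaussian k i)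
    (hw : w ∈ gaussian k i) : z * w ∈ gaussian k i := by
  obtain ⟨a, b, rfl⟩ := hz
  obtain ⟨c, d, rfl⟩ := hw
  refine ⟨a * c - b * d, a * d + b * c, ?_⟩
  simp only [map_sub, map_add, map_mul]
  linear_combination (algebraMap k E b * algebraMap k E d) * hi

theorem gaussian_add {i z w : E} (hz : z ∈ gaussian k i) (hw : w ∈ gaussian k i) :
    z + w ∈ gaussian k i := by
  obtain ⟨a, b, rfl⟩ := hz
  obtain ⟨c, d, rfl⟩ := hw
  exact ⟨a + c, b + d, by simp only [map_add]; ring⟩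

theorem algebraMap_mem_gaussian (i : E) (a : k) : algebraMap k E a ∈ gaussian k i :=
  ⟨a, 0, by simp⟩

theorem mem_gaussian_self (i : E) : i ∈ gaussian k i := ⟨0, 1, by simp⟩

end Gaussian

variable {k : Type*} [Field k] [IsRealClosed k]

/-- If instead `-(a ^ 2 + b ^ 2)` is a square, then `a = 0` by formal reality and the sum is `b ^
2`. -/
theorem isSquare_sq_add_sq (a b : k) : IsSquare (a ^ 2 + b ^ 2) := by
  rcases isSquare_or_isSquare_neg (a ^ 2 + b ^ 2) with h | ⟨c, hc⟩
  · exact h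
  · have ha : a = 0 := IsSemireal.eq_zero_of_sq_add_eq_zero (s := b * b + c * c)
      ((IsSumSq.mul_self b).add (IsSumSq.mul_self c)) (by linear_combination -hc)
    refine ⟨b, by rw [ha]; ring⟩

section Sqrt

variable {E : Type*} [Field E] [Algebra k E]

theorem exists_sq_eq_algebraMap {i : E} (hi : i ^ 2 = -1) (a : k) :
    ∃ x y : k, (algebraMap k E x + algebraMap k E y * i) ^ 2 = algebraMap k E a := by
  rcases isSquare_or_isSquare_neg a with ⟨c, hc⟩ | ⟨c, hc⟩
  · exact ⟨c, 0, by rw [hc]; simp [sq]⟩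
  · refine ⟨0, c, ?_⟩
    have : a = -(c * c) := by rw [← hc, neg_neg]
    rw [this]
    simp only [map_zero, zero_add, map_neg, map_mul]
    linear_combination (algebraMap k E c) ^ 2 * hi

theorem gaussian_inv {i : E} (hi : i ^ 2 = -1) {z : E} (hz : z ∈ gaussian k i) :
    z⁻¹ ∈ gaussian k i := by
  obtain ⟨a, b, rfl⟩ := hz
  by_cases h : a ^ 2 + b ^ 2 = 0
  · have ha : a = 0 := IsSemireal.eq_zero_of_sq_add_eq_zero (s := b ^ 2)
      (by rw [sq]; exact IsSumSq.mul_self b) h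
    have hb : b = 0 := by simpa [ha] using h
    exact ⟨0, 0, by simp [ha, hb]⟩
  · refine ⟨a / (a ^ 2 + b ^ 2), -b / (a ^ 2 + b ^ 2), ?_⟩
    have h' : (algebraMap k E a) ^ 2 + (algebraMap k E b) ^ 2 ≠ 0 := by
      rw [← map_pow, ← map_pow, ← map_add]
      exact (map_ne_zero _).mpr h
    apply inv_eq_of_mul_eq_one_right
    simp only [map_div₀, map_add, map_pow, map_neg]
    field_simp
    linear_combination -(algebraMap k E b) ^ 2 * hi

/-- The root of `a + b i` is `w + b i / (2 w)` with `w ^ 2 = (a + r) / 2` and `r ^ 2 = a ^ 2 + b ^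
2`. The sign of `r` is not chosen, so `w` may be zero; then `a = -r`, so `b = 0`, and a root of `a`
suffices. -/
theorem exists_sq_eq_of_mem_gaussian {i : E} (hi : i ^ 2 = -1) {z : E} (hz : z ∈ gaussian k i) :
    ∃ w ∈ gaussian k i, w ^ 2 = z := by
  obtain ⟨a, b, rfl⟩ := hz
  have : CharZero E := charZero_of_injective_algebraMap (algebraMap k E).injective
  obtain ⟨r, hr⟩ := isSquare_sq_add_sq a b
  obtain ⟨x, y, hxy⟩ := exists_sq_eq_algebraMap hi ((a + r) / 2)
  set w := algebraMap k E x + algebraMap k E y * i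
  have hw : w ∈ gaussian k i := ⟨x, y, rfl⟩
  by_cases h0 : w = 0
  · have har : a + r = 0 := by
      have : algebraMap k E ((a + r) / 2) = 0 := by rw [← hxy, h0]; simp
      have := (map_eq_zero _).mp this
      simpa using this
    have hb : b = 0 := by
      have : b ^ 2 = 0 := by linear_combination hr + (r - a) * har
      simpa using this
    obtain ⟨x, y, h⟩ := exists_sq_eq_algebraMap hi a
    exact ⟨_, ⟨x, y, rfl⟩, by rw [h, hb]; simp⟩
  · refine ⟨w + algebraMap k E (b / 2) * (w⁻¹ * i), gaussian_add hw (gaussian_mul hi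
      (algebraMap_mem_gaussian i _) (gaussian_mul hi (gaussian_inv hi hw) (mem_gaussian_self i))), ?_⟩
    have h1 : (algebraMap k E a) ^ 2 + (algebraMap k E b) ^ 2 = algebraMap k E r ^ 2 := by
      rw [← map_pow, ← map_pow, ← map_add, hr, map_mul, sq]
    have h2 : w ^ 2 * 2 = algebraMap k E a + algebraMap k E r := by
      rw [hxy, map_div₀, map_add, map_ofNat]; field_simp
    simp only [map_div₀, map_ofNat]
    field_simp
    linear_combination (algebraMap k E b) ^ 2 * hi + (2 * w ^ 2 - algebraMap k E a + algebraMap k E r) * h2 - h1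

end Sqrt


/-- The minimal polynomial of a primitive element has odd degree, hence a root in `k`, and being
irreducible it is linear. -/
theorem finrank_eq_one_of_odd {F : Type*} [Field F] [Algebra k F] [FiniteDimensional k F]
    (h : Odd (Module.finrank k F)) : Module.finrank k F = 1 := by
  obtain ⟨θ, hθ⟩ := Field.exists_primitive_element k F
  have hθint : IsIntegral k θ := IsIntegral.of_finite k θ
  have hdeg : (minpoly k θ).natDegree = Module.finrank k F := by
    rw [← IntermediateField.adjoin.finrank hθint, hθ, IntermediateField.finrank_top']
  obtain ⟨x, hx⟩ := exists_isRoot_of_odd_natDegree (f := minpoly k θ) (hdeg ▸ h)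
  rw [← hdeg]
  exact Polynomial.natDegree_eq_of_degree_eq_some
    (Polynomial.degree_eq_one_of_irreducible_of_root (minpoly.irreducible hθint) hx)

/-- The fixed field of a Sylow 2-subgroup has odd degree over `k`, so it is `k`. -/
theorem card_aut_eq_two_pow {E : Type*} [Field E] [Algebra k E] [FiniteDimensional k E]
    [IsGalois k E] : ∃ n, Nat.card (E ≃ₐ[k] E) = 2 ^ n := by
  have : Fact (Nat.Prime 2) := ⟨Nat.prime_two⟩
  let P : Sylow 2 (E ≃ₐ[k] E) := default
  have hP : Odd (P : Subgroup (E ≃ₐ[k] E)).index :=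
    Nat.odd_iff.mpr (Nat.two_dvd_ne_zero.mp P.not_dvd_index)
  have h1 : Module.finrank k (IntermediateField.fixedField (P : Subgroup (E ≃ₐ[k] E))) =
      (P : Subgroup (E ≃ₐ[k] E)).index := by
    rw [IntermediateField.finrank_eq_fixingSubgroup_index,
      IntermediateField.fixingSubgroup_fixedField]
  have h2 := finrank_eq_one_of_odd (h1 ▸ hP)
  rw [h1, Subgroup.index_eq_one] at h2
  obtain ⟨n, hn⟩ := IsPGroup.iff_card.mp P.isPGroup'
  refine ⟨n, ?_⟩
  rw [← hn]
  rw [h2, Subgroup.card_top]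

/-- Artin's argument: the Galois group over `F = k(i)` is a 2-group, so if it were nontrivial it
would have a subgroup of index two and `F` a quadratic extension, contradicting the existence of
square roots in `F`. -/
theorem mem_gaussian_of_isGalois {E : Type*} [Field E] [Algebra k E] [FiniteDimensional k E]
    [IsGalois k E] {i : E} (hi : i ^ 2 = -1) (z : E) : z ∈ gaussian k i := by
  have : Fact (Nat.Prime 2) := ⟨Nat.prime_two⟩
  have : CharZero E := charZero_of_injective_algebraMap (algebraMap k E).injective
  let F : IntermediateField k E :=
    { carrier := gaussian k i
      mul_mem' := gaussian_mul hi
      add_mem' := gaussian_add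
      algebraMap_mem' := algebraMap_mem_gaussian i
      inv_mem' := fun _ => gaussian_inv hi }
  suffices hF : F = ⊤ by
    change z ∈ F
    rw [hF]
    trivial
  by_contra hF
  have hH : F.fixingSubgroup ≠ ⊥ := fun h => hF (by
    rw [← IsGalois.fixedField_fixingSubgroup F, h, IntermediateField.fixedField_bot])
  obtain ⟨n, hn⟩ := card_aut_eq_two_pow (k := k) (E := E)
  have hpG : IsPGroup 2 (E ≃ₐ[k] E) := IsPGroup.of_card hn
  obtain ⟨m, hm⟩ := IsPGroup.iff_card.mp (hpG.to_subgroup F.fixingSubgroup)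
  have hm0 : m ≠ 0 := by
    rintro rfl
    exact hH (Subgroup.card_eq_one.mp (by simpa using hm))
  obtain ⟨m, rfl⟩ := Nat.exists_eq_succ_of_ne_zero hm0
  obtain ⟨H', hH'⟩ := Sylow.exists_subgroup_card_pow_prime (G := F.fixingSubgroup) 2
    (n := m) (hm ▸ pow_dvd_pow 2 (Nat.le_succ m))
  let H : Subgroup (E ≃ₐ[k] E) := H'.map F.fixingSubgroup.subtype
  have hHle : H ≤ F.fixingSubgroup := Subgroup.map_subtype_le H'
  have hHcard : Nat.card H = 2 ^ m := by
    rw [← hH']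
    exact Nat.card_congr (H'.equivMapOfInjective _ (Subgroup.subtype_injective _)).symm.toEquiv
  let L := IntermediateField.fixedField H
  have hFL : F ≤ L := (IntermediateField.le_iff_le H F).mpr hHle
  have hne : ∃ y ∈ L, y ∉ F := by
    by_contra! hcon
    have hLF : L = F := le_antisymm hcon hFL
    have : F.fixingSubgroup = H := by rw [← hLF, IntermediateField.fixingSubgroup_fixedField]
    rw [this, hHcard] at hm
    exact absurd hm (Nat.pow_lt_pow_right one_lt_two (Nat.lt_succ_self m)).ne
  obtain ⟨y, hyL, hyF⟩ := hne
  have hindex : H'.index = 2 := by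
    have h := H'.card_mul_index
    rw [hH', hm, pow_succ] at h
    exact Nat.eq_of_mul_eq_mul_left (pow_pos two_pos m) h
  have hfix : ∀ x : E, (∀ ρ ∈ F.fixingSubgroup, ρ x = x) → x ∈ F := fun x hx => by
    rw [← IsGalois.fixedField_fixingSubgroup F, IntermediateField.mem_fixedField_iff]
    exact hx
  have hyH : ∀ ρ : F.fixingSubgroup, ρ ∈ H' → ρ.1 y = y := fun ρ hρ =>
    (IntermediateField.mem_fixedField_iff H y).mp hyL ρ.1 ⟨ρ, hρ, rfl⟩
  obtain ⟨τ, hτ⟩ : ∃ τ, τ ∉ H' := by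
    by_contra! hcon
    rw [(Subgroup.eq_top_iff' H').mpr hcon, Subgroup.index_top] at hindex
    omega
  have hρτ : ∀ ρ, ρ ∉ H' → ρ.1 y = τ.1 y := fun ρ hρ => by
    have h1 : τ⁻¹ * ρ ∈ H' := by
      rw [Subgroup.mul_mem_iff_of_index_two hindex, inv_mem_iff]
      tauto
    have h2 := congrArg τ.1 (hyH _ h1)
    have h3 : τ.1 ((τ⁻¹ * ρ).1 y) = ρ.1 y := by
      rw [← AlgEquiv.mul_apply, ← Subgroup.coe_mul, mul_inv_cancel_left]
    rw [← h3, h2]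
  -- The difference of the two conjugates of `y` over `F` is fixed by `H'` and negated outside it,
  -- so its square lies in `F`. A square root in `F` puts `w` in `F`, hence `w = 0`, and then `y` is
  -- in `F`.
  set w := y - τ.1 y with hw
  have hwH : ∀ ρ ∈ H', ρ.1 w = w := fun ρ hρ => by
    have h1 : ρ * τ ∉ H' := by
      rw [Subgroup.mul_mem_iff_of_index_two hindex]
      tauto
    have h2 := hρτ _ h1
    rw [Subgroup.coe_mul, AlgEquiv.mul_apply] at h2
    rw [hw, map_sub, h2, hyH ρ hρ]
  have hwn : ∀ ρ, ρ ∉ H' → ρ.1 w = -w := fun ρ hρ => by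
    have h1 : ρ * τ ∈ H' := by
      rw [Subgroup.mul_mem_iff_of_index_two hindex]
      tauto
    have h2 := hyH _ h1
    rw [Subgroup.coe_mul, AlgEquiv.mul_apply] at h2
    rw [hw, map_sub, h2, hρτ ρ hρ, neg_sub]
  have hw2 : w ^ 2 ∈ F := hfix _ fun ρ hρ => by
    rw [map_pow]
    by_cases h : (⟨ρ, hρ⟩ : F.fixingSubgroup) ∈ H'
    · rw [hwH _ h]
    · rw [hwn _ h, neg_sq]
  obtain ⟨v, hvF, hv⟩ := exists_sq_eq_of_mem_gaussian hi hw2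
  have hwF : w ∈ F := by
    rcases sq_eq_sq_iff_eq_or_eq_neg.mp hv with h | h
    · exact h ▸ hvF
    · rw [← neg_eq_iff_eq_neg.mpr h]
      exact F.neg_mem hvF
  have hw0 : w = 0 := by
    have h1 : τ.1 w = w := τ.2 ⟨w, hwF⟩
    rw [hwn τ hτ] at h1
    exact neg_eq_self.mp h1
  refine hyF (hfix y fun ρ hρ => ?_)
  by_cases h : (⟨ρ, hρ⟩ : F.fixingSubgroup) ∈ H'
  · exact hyH _ h
  · exact (hρτ _ h).trans (sub_eq_zero.mp hw0).symm

/-- Inside a normal extension containing `Z` and `i`, each element of `Z` is some `x + y i`. One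
element with `y ≠ 0` already puts `i` in `Z`. -/
theorem surjective_algebraMap_or_gaussian (Z : Type*) [Field Z] [Algebra k Z]
    [FiniteDimensional k Z] : Function.Surjective (algebraMap k Z) ∨
      ∃ j : Z, j ^ 2 = -1 ∧ ∀ z : Z, z ∈ gaussian k j := by
  let C := AlgebraicClosure k
  let φ : Z →ₐ[k] C := IsAlgClosed.lift
  obtain ⟨i, hi⟩ := IsAlgClosed.exists_pow_nat_eq (-1 : C) two_pos
  have : FiniteDimensional k (IntermediateField.adjoin k {i}) :=
    IntermediateField.adjoin.finiteDimensional (Algebra.IsIntegral.isIntegral i)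
  let F : IntermediateField k C := φ.fieldRange ⊔ IntermediateField.adjoin k {i}
  have : FiniteDimensional k φ.fieldRange :=
    LinearMap.finiteDimensional_range φ.toLinearMap
  have : FiniteDimensional k F := IntermediateField.finiteDimensional_sup _ _
  have hinj : Function.Injective φ := (φ : Z →+* C).injective
  have hFE : F ≤ IntermediateField.normalClosure k F C := F.le_normalClosure
  let i' : IntermediateField.normalClosure k F C := ⟨i, hFE (le_sup_right (a := φ.fieldRange)
    (IntermediateField.mem_adjoin_simple_self k i))⟩
  have hφ : ∀ z : Z, ∃ x y : k, φ z = algebraMap k C x + algebraMap k C y * i := fun z => by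
    obtain ⟨x, y, h⟩ := mem_gaussian_of_isGalois (k := k) (i := i') (Subtype.ext hi)
      ⟨φ z, hFE (le_sup_left (b := IntermediateField.adjoin k {i}) ⟨z, rfl⟩)⟩
    exact ⟨x, y, congrArg Subtype.val h⟩
  by_cases hs : Function.Surjective (algebraMap k Z)
  · exact Or.inl hs
  · right
    simp only [Function.Surjective, not_forall, not_exists] at hs
    obtain ⟨z, hz⟩ := hs
    obtain ⟨x, y, h⟩ := hφ z
    have hy : y ≠ 0 := by
      rintro rfl
      refine hz x (hinj ?_)
      rw [h, φ.commutes]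
      simp
    have hy' : algebraMap k C y ≠ 0 := (map_ne_zero _).mpr hy
    let j : Z := algebraMap k Z y⁻¹ * (z - algebraMap k Z x)
    have hj : φ j = i := by
      simp only [j, map_mul, map_sub, φ.commutes, h, map_inv₀]
      rw [add_sub_cancel_left, inv_mul_cancel_left₀ hy']
    refine ⟨j, hinj ?_, fun w => ?_⟩
    · rw [map_pow, hj, hi, map_neg, map_one]
    · obtain ⟨a, b, hw⟩ := hφ w
      refine ⟨a, b, hinj ?_⟩
      simp only [map_add, map_mul, φ.commutes, hw, hj]

end IsRealClosed

/-! ### The field `k(i)` -/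

namespace AdjoinI

variable {k : Type*} [Field k]

open IsRealClosed

variable (k) in
theorem exists_sq_eq_neg_one : ∃ i : AdjoinI k, i ^ 2 = -1 := by
  have h := (Polynomial.SplittingField.splits (Polynomial.X ^ 2 + 1 : Polynomial k))
  obtain ⟨i, hi⟩ := Polynomial.Splits.exists_eval_eq_zero h (by
    rw [Polynomial.degree_map]
    have : (Polynomial.X ^ 2 + 1 : Polynomial k).degree = 2 := by compute_degree!
    rw [this]
    decide)
  exact ⟨i, by simpa [add_eq_zero_iff_eq_neg] using hi⟩

theorem mem_gaussian {i : AdjoinI k} (hi : i ^ 2 = -1) (z : AdjoinI k) : z ∈ gaussian k i := by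
  have hz : z ∈ Algebra.adjoin k
      ((Polynomial.X ^ 2 + 1 : Polynomial k).rootSet (AdjoinI k)) := by
    rw [Polynomial.SplittingField.adjoin_rootSet]
    trivial
  induction hz using Algebra.adjoin_induction with
  | mem x hx =>
    have h1 := (Polynomial.mem_rootSet'.mp hx).2
    have h2 : x ^ 2 = i ^ 2 := by
      rw [hi]
      simpa [add_eq_zero_iff_eq_neg] using h1
    rcases sq_eq_sq_iff_eq_or_eq_neg.mp h2 with rfl | rfl
    · exact mem_gaussian_self x
    · exact ⟨0, -1, by simp⟩
  | algebraMap r => exact algebraMap_mem_gaussian i r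
  | add x y _ _ hx hy => exact gaussian_add hx hy
  | mul x y _ _ hx hy => exact gaussian_mul hi hx hy

instance [CharZero k] : IsGalois k (AdjoinI k) where
  to_isSeparable := inferInstance
  to_normal := inferInstance

variable [IsSemireal k]

theorem sq_ne_neg_one_algebraMap {i : AdjoinI k} (hi : i ^ 2 = -1) (x : k) :
    algebraMap k (AdjoinI k) x ≠ i := by
  rintro rfl
  exact sq_ne_neg_one x ((algebraMap k (AdjoinI k)).injective (by simpa using hi))

theorem apply_i_of_ne_one {i : AdjoinI k} (hi : i ^ 2 = -1) {ω : AdjoinI k ≃ₐ[k] AdjoinI k}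
    (hω : ω ≠ 1) : ω i = -i := by
  have h : (ω i) ^ 2 = i ^ 2 := by rw [← map_pow, hi, map_neg, map_one]
  refine (sq_eq_sq_iff_eq_or_eq_neg.mp h).resolve_left fun h1 => hω ?_
  ext z
  obtain ⟨a, b, rfl⟩ := mem_gaussian hi z
  simp [h1]

/-- The norm of `k(i)|k` is a sum of squares. -/
theorem exists_isSumSq_mul_apply {ω : AdjoinI k ≃ₐ[k] AdjoinI k} (hω : ω ≠ 1) (z : AdjoinI k) :
    ∃ s : k, IsSumSq s ∧ ω z * z = algebraMap k (AdjoinI k) s := by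
  obtain ⟨i, hi⟩ := exists_sq_eq_neg_one k
  obtain ⟨a, b, rfl⟩ := mem_gaussian hi z
  refine ⟨a * a + b * b, (IsSumSq.mul_self a).add (IsSumSq.mul_self b), ?_⟩
  simp only [map_add, map_mul, AlgEquiv.commutes, apply_i_of_ne_one hi hω]
  linear_combination - (algebraMap k (AdjoinI k) b) ^ 2 * hi

/-- A norm is a sum of squares, and the only such root of unity is `1`. -/
theorem mul_apply_eq_one_of_pow_eq_one {ω : AdjoinI k ≃ₐ[k] AdjoinI k} (hω : ω ≠ 1)
    {z : AdjoinI k} {n : ℕ} (hn : n ≠ 0) (hz : (ω z * z) ^ n = 1) : ω z * z = 1 := by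
  obtain ⟨s, hs, h⟩ := exists_isSumSq_mul_apply hω z
  rw [h] at hz ⊢
  rw [hs.eq_one_of_pow_eq_one hn ((algebraMap k (AdjoinI k)).injective (by simpa using hz)),
    map_one]

theorem exists_eq_algebraMap_of_apply_eq {ω : AdjoinI k ≃ₐ[k] AdjoinI k} (hω : ω ≠ 1)
    {z : AdjoinI k} (hz : ω z = z) : ∃ a : k, z = algebraMap k (AdjoinI k) a := by
  obtain ⟨i, hi⟩ := exists_sq_eq_neg_one k
  obtain ⟨a, b, rfl⟩ := mem_gaussian hi z
  refine ⟨a, ?_⟩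
  simp only [map_add, map_mul, AlgEquiv.commutes, apply_i_of_ne_one hi hω] at hz
  have : CharZero (AdjoinI k) :=
    charZero_of_injective_algebraMap (algebraMap k (AdjoinI k)).injective
  have h2 : (2 : AdjoinI k) * (algebraMap k (AdjoinI k) b * i) = 0 := by linear_combination -hz
  rw [(mul_eq_zero.mp h2).resolve_left two_ne_zero, add_zero]

theorem eq_of_ne_one {ω ω' : AdjoinI k ≃ₐ[k] AdjoinI k} (hω : ω ≠ 1) (hω' : ω' ≠ 1) :
    ω = ω' := by
  obtain ⟨i, hi⟩ := exists_sq_eq_neg_one k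
  ext z
  obtain ⟨a, b, rfl⟩ := mem_gaussian hi z
  simp [apply_i_of_ne_one hi hω, apply_i_of_ne_one hi hω']

variable (k) in
theorem exists_aut_ne_one : ∃ ω : AdjoinI k ≃ₐ[k] AdjoinI k, ω ≠ 1 := by
  obtain ⟨i, hi⟩ := exists_sq_eq_neg_one k
  by_contra! h
  obtain ⟨x, hx⟩ := (IsGalois.mem_range_algebraMap_iff_fixed (F := k) i).mpr
    fun ω => by rw [h ω]; rfl
  exact sq_ne_neg_one_algebraMap hi x hx

/-- Hilbert 90 for `k(i)|k`. -/
theorem exists_apply_mul_eq {ω : AdjoinI k ≃ₐ[k] AdjoinI k} (hω : ω ≠ 1) {z : AdjoinI k}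
    (hz : ω z * z = 1) : ∃ c : AdjoinI k, c ≠ 0 ∧ ω c * z = c := by
  -- The usual witness `1 + z` satisfies `ω (1 + z) z = z + 1`; it only fails for `z = -1`, where
  -- `i` serves.
  by_cases h : 1 + z = 0
  · obtain ⟨i, hi⟩ := exists_sq_eq_neg_one k
    refine ⟨i, fun h0 => ?_, ?_⟩
    · rw [h0] at hi
      simp at hi
    · rw [apply_i_of_ne_one hi hω]
      linear_combination -i * h
  · exact ⟨1 + z, h, by rw [map_add, map_one]; linear_combination hz⟩

end AdjoinI

/-! ### Galois algebras: dimension and simple quotients -/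

open scoped Pointwise TensorProduct

section Dimension

variable {k G A : Type*} [Field k] [Group G] [Ring A] [Algebra k A] [MulSemiringAction G A]
  [SMulCommClass G k A]

theorem galoisCanMap_tmul (x y : A) (g : G) : galoisCanMap k G A (x ⊗ₜ y) g = x * g • y := rfl

/-- With `n = dim A`, compare the dimensions `n * n` and `|G| * n`. -/
theorem card_le_finrank_of_surjective_galoisCanMap [Finite G] [Nontrivial A]
    [FiniteDimensional k A] (h : Function.Surjective (galoisCanMap k G A)) :
    Nat.card G ≤ Module.finrank k A := by
  cases nonempty_fintype G
  have h1 := LinearMap.finrank_le_finrank_of_surjective h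
  rw [Module.finrank_tensorProduct, Module.finrank_pi_fintype, Finset.sum_const, Finset.card_univ,
    smul_eq_mul, ← Nat.card_eq_fintype_card] at h1
  exact Nat.le_of_mul_le_mul_right h1 Module.finrank_pos

namespace IsGaloisAlgebra

theorem nontrivial (hA : IsGaloisAlgebra k G A) : Nontrivial A := by
  have := hA.faithfullyFlat
  exact (TensorProduct.lid k A).symm.toEquiv.nontrivial_congr.mpr inferInstance

/-- A `k`-basis of `A` is an `A`-basis of `A ⊗ A`. The canonical map is `A`-linear and identifies
this free module with the finitely generated `G → A`, so the basis is finite. -/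
theorem finiteDimensional [Finite G] (hA : IsGaloisAlgebra k G A) : FiniteDimensional k A := by
  have := hA.nontrivial
  let b := Algebra.TensorProduct.basis A (Module.Basis.ofVectorSpace k A)
  let e : (A ⊗[k] A) →ₗ[A] (G → A) :=
    { galoisCanMap k G A with
      map_smul' := fun a t => by
        change galoisCanMap k G A (a • t) = a • galoisCanMap k G A t
        induction t with
        | zero => simp
        | add t t' h h' => rw [smul_add, map_add, map_add, smul_add, h, h']
        | tmul x y =>
          funext g
          rw [TensorProduct.smul_tmul', Pi.smul_apply, galoisCanMap_tmul, galoisCanMap_tmul,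
            smul_eq_mul, smul_eq_mul, mul_assoc] }
  let e' : (A ⊗[k] A) ≃ₗ[A] (G → A) := LinearEquiv.ofBijective e hA.can_bijective
  have : Module.Finite A (A ⊗[k] A) := Module.Finite.equiv e'.symm
  have := Module.Finite.finite_basis b
  exact Module.Finite.of_basis (Module.Basis.ofVectorSpace k A)

theorem finrank_eq_card [Finite G] (hA : IsGaloisAlgebra k G A) :
    Module.finrank k A = Nat.card G := by
  cases nonempty_fintype G
  have := hA.nontrivial
  have := hA.finiteDimensional
  have h1 := (LinearEquiv.ofBijective _ hA.can_bijective).finrank_eq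
  rw [Module.finrank_tensorProduct, Module.finrank_pi_fintype, Finset.sum_const, Finset.card_univ,
    smul_eq_mul, ← Nat.card_eq_fintype_card] at h1
  exact Nat.eq_of_mul_eq_mul_right Module.finrank_pos h1

end IsGaloisAlgebra

end Dimension

section Quotient

variable {G A : Type*} [Group G] [Ring A] [MulSemiringAction G A] (M : Ideal A)

theorem Ideal.smul_mem_iff_of_mem_stabilizer {g : G}
    (hg : g ∈ MulAction.stabilizer G (M : Set A)) {a : A} : g • a ∈ M ↔ a ∈ M :=
  MulAction.mem_stabilizer_set.mp hg a

variable [M.IsTwoSided]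

/-- The stabilizer of a two-sided ideal acts on the quotient. -/
instance Ideal.quotientStabilizerAction :
    MulSemiringAction (MulAction.stabilizer G (M : Set A)) (A ⧸ M) where
  smul s := Ideal.quotientMap M (MulSemiringAction.toRingHom G A s.1)
    fun _ ha => (M.smul_mem_iff_of_mem_stabilizer s.2).mpr ha
  one_smul b := by
    obtain ⟨a, rfl⟩ := Ideal.Quotient.mk_surjective b
    exact congrArg (Ideal.Quotient.mk M) (one_smul G a)
  mul_smul s t b := by
    obtain ⟨a, rfl⟩ := Ideal.Quotient.mk_surjective b
    exact congrArg (Ideal.Quotient.mk M) (mul_smul s.1 t.1 a)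
  smul_zero s := map_zero (Ideal.quotientMap M _ _)
  smul_add s := map_add (Ideal.quotientMap M _ _)
  smul_one s := map_one (Ideal.quotientMap M _ _)
  smul_mul s := map_mul (Ideal.quotientMap M _ _)

theorem Ideal.smul_quotient_mk (s : MulAction.stabilizer G (M : Set A)) (a : A) :
    s • Ideal.Quotient.mk M a = Ideal.Quotient.mk M (s.1 • a) := rfl

variable {k : Type*} [Field k] [Algebra k A] [SMulCommClass G k A]

instance Ideal.quotientStabilizerSMulComm :
    SMulCommClass (MulAction.stabilizer G (M : Set A)) k (A ⧸ M) where
  smul_comm s c b := by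
    obtain ⟨a, rfl⟩ := Ideal.Quotient.mk_surjective b
    exact congrArg (Ideal.Quotient.mk M) (smul_comm s.1 c a)

/-- Lift a function on the stabilizer to `A`, extend it by zero to `G`, and push a preimage under
the canonical map of `A` down to the quotient. -/
theorem IsGaloisAlgebra.surjective_galoisCanMap_quotient (hA : IsGaloisAlgebra k G A) :
    Function.Surjective (galoisCanMap k (MulAction.stabilizer G (M : Set A)) (A ⧸ M)) := by
  classical
  intro f
  choose c hc using fun s => Ideal.Quotient.mk_surjective (f s)
  obtain ⟨t, ht⟩ := hA.can_bijective.2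
    (fun g => if hg : g ∈ MulAction.stabilizer G (M : Set A) then c ⟨g, hg⟩ else 0)
  let π : A →ₗ[k] A ⧸ M := (Ideal.Quotient.mkₐ k M).toLinearMap
  have key : ∀ t (s : MulAction.stabilizer G (M : Set A)),
      galoisCanMap k (MulAction.stabilizer G (M : Set A)) (A ⧸ M) (TensorProduct.map π π t) s =
        π (galoisCanMap k G A t s.1) := fun t s => by
    induction t with
    | zero => simp
    | add t t' h h' => simp only [map_add, Pi.add_apply, h, h']
    | tmul x y =>
      rw [TensorProduct.map_tmul, galoisCanMap_tmul, galoisCanMap_tmul]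
      exact (map_mul (Ideal.Quotient.mk M) x (s.1 • y)).symm
  refine ⟨TensorProduct.map π π t, funext fun s => ?_⟩
  rw [key, ht]
  simp only [s.2, dite_true]
  exact hc s

/-- The canonical map of the quotient is surjective for all of `G`, so `dim (A ⧸ M) ≥ |G| = dim A`.
-/
theorem IsGaloisAlgebra.eq_bot_of_stable [Finite G] (hA : IsGaloisAlgebra k G A) (hM : M ≠ ⊤)
    (hstab : ∀ g : G, g ∈ MulAction.stabilizer G (M : Set A)) : M = ⊥ := by
  have := hA.finiteDimensional
  have : Nontrivial (A ⧸ M) := Ideal.Quotient.nontrivial_iff.mpr hM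
  have h1 := card_le_finrank_of_surjective_galoisCanMap (hA.surjective_galoisCanMap_quotient M)
  rw [(Subgroup.eq_top_iff' _).mpr hstab, Subgroup.card_top, ← hA.finrank_eq_card] at h1
  have h2 := LinearMap.injective_iff_surjective_of_finrank_eq_finrank
    (f := (Ideal.Quotient.mkₐ k M).toLinearMap) (le_antisymm h1
      (LinearMap.finrank_le_finrank_of_surjective
        (f := (Ideal.Quotient.mkₐ k M).toLinearMap) (Ideal.Quotient.mkₐ_surjective k M)))
  have h3 := h2.mpr (Ideal.Quotient.mkₐ_surjective k M)
  rw [eq_bot_iff]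
  intro a ha
  exact h3 ((Ideal.Quotient.eq_zero_iff_mem.mpr ha).trans (map_zero (Ideal.Quotient.mk M)).symm)

end Quotient

/-! ### Maximal two-sided ideals -/

/-- `M` is maximal among the proper two-sided ideals. -/
structure IsMaximalTwoSided {A : Type*} [Ring A] (M : Ideal A) : Prop where
  isTwoSided : M.IsTwoSided
  ne_top : M ≠ ⊤
  eq_of_le : ∀ I : Ideal A, I.IsTwoSided → M ≤ I → I ≠ ⊤ → I = M

theorem exists_isMaximalTwoSided (A : Type*) [Ring A] [Nontrivial A] [IsNoetherianRing A] :
    ∃ M : Ideal A, IsMaximalTwoSided M := by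
  obtain ⟨M, ⟨h1, h2⟩, h3⟩ := WellFounded.has_min (r := ((· > ·) : Ideal A → Ideal A → Prop))
    wellFounded_gt {I | I.IsTwoSided ∧ I ≠ ⊤} ⟨⊥, inferInstance, bot_ne_top⟩
  refine ⟨M, h1, h2, fun I hI hle hne => ?_⟩
  by_contra hcon
  exact h3 I ⟨hI, hne⟩ (lt_of_le_of_ne hle (Ne.symm hcon))

namespace IsMaximalTwoSided

variable {A : Type*} [Ring A] {M : Ideal A}

theorem isSimpleRing_quotient (hM : IsMaximalTwoSided M) [M.IsTwoSided] : IsSimpleRing (A ⧸ M) := by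
  have : Nontrivial (A ⧸ M) := Ideal.Quotient.nontrivial_iff.mpr hM.ne_top
  refine ⟨⟨fun J => ?_⟩⟩
  let I : Ideal A := J.asIdeal.comap (Ideal.Quotient.mk M)
  have hI : I.IsTwoSided := ⟨fun {a} b ha => by
    change Ideal.Quotient.mk M (a * b) ∈ J
    rw [map_mul]
    exact J.mul_mem_right _ _ ha⟩
  have hle : M ≤ I := fun a ha => by
    change Ideal.Quotient.mk M a ∈ J
    rw [Ideal.Quotient.eq_zero_iff_mem.mpr ha]
    exact J.zero_mem
  by_cases hI' : I = ⊤
  · right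
    rw [eq_top_iff]
    intro b _
    obtain ⟨a, rfl⟩ := Ideal.Quotient.mk_surjective b
    have : a ∈ I := hI' ▸ Submodule.mem_top
    exact this
  · left
    rw [eq_bot_iff]
    intro b hb
    obtain ⟨a, rfl⟩ := Ideal.Quotient.mk_surjective b
    have : a ∈ M := hM.eq_of_le I hI hle hI' ▸ (show a ∈ I from hb)
    rw [Ideal.Quotient.eq_zero_iff_mem.mpr this]
    exact TwoSidedIdeal.zero_mem _

/-- If the sum is proper, maximality of `M` gives `f⁻¹(M) ≤ M`. Transporting by `f` gives `M ≤
f(M)`, and maximality applies once more to yield equality. -/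
theorem comap_sup_eq_top (hM : IsMaximalTwoSided M) (f : A ≃+* A)
    (hf : ¬ ∀ a, f a ∈ M ↔ a ∈ M) : M.comap (f : A →+* A) ⊔ M = ⊤ := by
  have := hM.isTwoSided
  have htwo : ∀ g : A ≃+* A, (M.comap (g : A →+* A)).IsTwoSided := fun g => ⟨fun {a} b ha => by
    change g (a * b) ∈ M
    rw [map_mul]
    exact M.mul_mem_right _ ha⟩
  have := htwo f
  by_contra hne
  have hsup : (M.comap (f : A →+* A) ⊔ M).IsTwoSided := ⟨fun {a} b ha => by
    obtain ⟨x, hx, y, hy, rfl⟩ := Submodule.mem_sup.mp ha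
    rw [add_mul]
    exact Submodule.add_mem_sup (Ideal.mul_mem_right _ _ hx) (Ideal.mul_mem_right _ _ hy)⟩
  have h1 := hM.eq_of_le _ hsup le_sup_right hne
  have h2 : ∀ a, f a ∈ M → a ∈ M := fun a ha => h1 ▸ (le_sup_left (b := M) (show a ∈ M.comap _ from ha))
  have h3 : M.comap (f.symm : A →+* A) = M := by
    refine hM.eq_of_le _ (htwo _) (fun a ha => h2 _ ?_) fun h => hM.ne_top ?_
    · simpa using ha
    · rw [Ideal.eq_top_iff_one] at h ⊢
      simpa using h
  refine hf fun a => ⟨h2 a, fun ha => ?_⟩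
  have : f a ∈ M.comap (f.symm : A →+* A) := by simpa using ha
  rwa [h3] at this

/-- Chinese remainder theorem: multiply, over all `i`, elements of `f i ⁻¹(M)` that are congruent to
`1` modulo `M`. -/
theorem exists_mem_of_forall_ne (hM : IsMaximalTwoSided M) {ι : Type*} (F : Finset ι)
    (f : ι → A ≃+* A) (hf : ∀ i ∈ F, ¬ ∀ a, f i a ∈ M ↔ a ∈ M) :
    ∃ e : A, (∀ i ∈ F, f i e ∈ M) ∧ 1 - e ∈ M := by
  classical
  have := hM.isTwoSided
  induction F using Finset.induction_on with
  | empty => exact ⟨1, by simp⟩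
  | insert i F _ ih =>
    obtain ⟨e, he, he1⟩ := ih fun j hj => hf j (Finset.mem_insert_of_mem hj)
    have h := hM.comap_sup_eq_top (f i) (hf i (Finset.mem_insert_self i F))
    obtain ⟨e', he', c, hc, hec⟩ := Submodule.mem_sup.mp ((Ideal.eq_top_iff_one _).mp h)
    refine ⟨e * e', fun j hj => ?_, ?_⟩
    · rw [map_mul]
      rcases Finset.mem_insert.mp hj with rfl | hj
      · exact M.mul_mem_left _ he'
      · exact M.mul_mem_right _ (he j hj)
    · have : 1 - e * e' = (1 - e) + e * c := by rw [← hec, eq_sub_of_add_eq hec]; noncomm_ring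
      rw [this]
      exact M.add_mem he1 (M.mul_mem_left _ hc)

end IsMaximalTwoSided

/-! ### The simple quotient of a Galois algebra -/

theorem smul_equivariantAut_comm {k G A : Type*} [Field k] [Group G] [Ring A] [Algebra k A]
    [MulSemiringAction G A] (φ : equivariantAut k G A) (g : G) (a : A) :
    φ • g • a = g • φ • a := φ.2 g a

namespace IsGaloisAlgebra

variable {k G A : Type*} [Field k] [Group G] [Finite G] [Ring A] [Algebra k A]
  [MulSemiringAction G A] {M : Ideal A}

theorem exists_isolating (hM : IsMaximalTwoSided M) :
    ∃ e : A, (∀ g : G, g ∉ MulAction.stabilizer G (M : Set A) → g • e ∈ M) ∧ 1 - e ∈ M := by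
  classical
  cases nonempty_fintype G
  obtain ⟨e, he, he1⟩ := hM.exists_mem_of_forall_ne
    (Finset.univ.filter fun g : G => g ∉ MulAction.stabilizer G (M : Set A))
    (fun g => MulSemiringAction.toRingEquiv G A g)
    (fun g hg h => (Finset.mem_filter.mp hg).2 (MulAction.mem_stabilizer_set.mpr h))
  exact ⟨e, fun g hg => he g (by simpa using hg), he1⟩

variable [SMulCommClass G k A] [M.IsTwoSided]

/-- A Galois algebra is `G`-simple: no nonzero element has its orbit in a proper ideal. -/
theorem eq_zero_of_forall_smul_mem (hA : IsGaloisAlgebra k G A) (hM : M ≠ ⊤) {a : A}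
    (ha : ∀ g : G, g • a ∈ M) : a = 0 := by
  let I : Ideal A :=
    { carrier := {a | ∀ g : G, g • a ∈ M}
      add_mem' := fun ha hb g => by rw [smul_add]; exact M.add_mem (ha g) (hb g)
      zero_mem' := fun g => by rw [smul_zero]; exact M.zero_mem
      smul_mem' := fun c a ha g => by
        rw [smul_eq_mul, smul_mul']; exact M.mul_mem_left _ (ha g) }
  have hI : I.IsTwoSided := ⟨fun {a} b ha g => by
    rw [smul_mul']; exact M.mul_mem_right _ (ha g)⟩
  have hbot : I = ⊥ := by
    refine hA.eq_bot_of_stable I (fun h => hM ?_) fun g => MulAction.mem_stabilizer_set.mpr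
      fun a => ⟨fun h x => ?_, fun h x => ?_⟩
    · rw [Ideal.eq_top_iff_one] at h ⊢
      simpa using h 1
    · have := h (x * g⁻¹)
      rwa [smul_smul, inv_mul_cancel_right] at this
    · have := h (x * g)
      rwa [mul_smul] at this
  have : a ∈ I := ha
  rwa [hbot] at this

/-- The residues of `t.out⁻¹ • a` are the coordinates of `a` along the orbit of `M`. Translates of
an element that is `1` modulo `M` and `0` modulo the other ideals of the orbit glue prescribed
coordinates. -/
theorem exists_smul_quotient_eq (hM : IsMaximalTwoSided M)
    (b : G ⧸ MulAction.stabilizer G (M : Set A) → A ⧸ M) :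
    ∃ a : A, ∀ t, Ideal.Quotient.mk M (t.out⁻¹ • a) = b t := by
  classical
  cases nonempty_fintype G
  obtain ⟨e, he, he1⟩ := exists_isolating (G := G) hM
  choose c hc using fun t => Ideal.Quotient.mk_surjective (b t)
  refine ⟨∑ t : G ⧸ MulAction.stabilizer G (M : Set A), t.out • (e * c t), fun t => ?_⟩
  rw [Finset.smul_sum, map_sum, Finset.sum_eq_single t]
  · have h1 : Ideal.Quotient.mk M e = 1 := by
      have := Ideal.Quotient.eq_zero_iff_mem.mpr he1
      rw [map_sub, map_one, sub_eq_zero] at this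
      exact this.symm
    rw [inv_smul_smul, map_mul, h1, one_mul, hc]
  · intro t' _ ht'
    rw [smul_smul, smul_mul', Ideal.Quotient.eq_zero_iff_mem]
    refine M.mul_mem_right _ (he _ fun h => ht' ?_)
    rw [← t.out_eq', ← t'.out_eq']
    exact (QuotientGroup.eq.mpr h).symm
  · simp

/-- The canonical map of the quotient bounds the dimension from below; the surjection of `A` onto
`|G/S|` copies of the quotient bounds it from above. -/
theorem finrank_quotient_eq_card (hA : IsGaloisAlgebra k G A) (hM : IsMaximalTwoSided M) :
    Module.finrank k (A ⧸ M) = Nat.card (MulAction.stabilizer G (M : Set A)) := by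
  cases nonempty_fintype G
  classical
  have := hA.finiteDimensional
  have : Nontrivial (A ⧸ M) := Ideal.Quotient.nontrivial_iff.mpr hM.ne_top
  refine le_antisymm ?_ (card_le_finrank_of_surjective_galoisCanMap
    (hA.surjective_galoisCanMap_quotient M))
  let f : A →ₗ[k] (G ⧸ MulAction.stabilizer G (M : Set A) → A ⧸ M) :=
    LinearMap.pi fun t => (Ideal.Quotient.mkₐ k M).toLinearMap ∘ₗ
      DistribSMul.toLinearMap k A t.out⁻¹
  have hf : Function.Surjective f := fun b => by
    obtain ⟨a, ha⟩ := exists_smul_quotient_eq hM b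
    exact ⟨a, funext ha⟩
  have h1 := LinearMap.finrank_le_finrank_of_surjective hf
  rw [Module.finrank_pi_fintype, Finset.sum_const, Finset.card_univ, smul_eq_mul,
    hA.finrank_eq_card, ← Nat.card_eq_fintype_card, ← Subgroup.index,
    ← (MulAction.stabilizer G (M : Set A)).index_mul_card] at h1
  exact Nat.le_of_mul_le_mul_left h1 (Nat.pos_of_ne_zero Subgroup.index_ne_zero_of_finite)

/-- A Galois algebra is induced from each of its simple quotients. -/
theorem isomorphic_inducedAlgebra (hA : IsGaloisAlgebra k G A) (hM : IsMaximalTwoSided M) :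
    GAlgIsomorphic k G A (inducedAlgebra k (MulAction.stabilizer G (M : Set A)) (A ⧸ M)) := by
  let f : A →ₐ[k] inducedAlgebra k (MulAction.stabilizer G (M : Set A)) (A ⧸ M) :=
    { toFun := fun a => ⟨fun g => Ideal.Quotient.mk M (g • a), fun s g => by
        rw [Ideal.smul_quotient_mk, ← mul_smul]⟩
      map_one' := Subtype.ext (funext fun g => by simp)
      map_mul' := fun a b => Subtype.ext (funext fun g => by simp [smul_mul'])
      map_zero' := Subtype.ext (funext fun g => by simp)
      map_add' := fun a b => Subtype.ext (funext fun g => by simp)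
      commutes' := fun c => Subtype.ext (funext fun g => by
        simp only [smul_algebraMap]; rfl) }
  have hf : ∀ a g, (f a).1 g = Ideal.Quotient.mk M (g • a) := fun _ _ => rfl
  have hinj : Function.Injective f := (injective_iff_map_eq_zero f).mpr fun a ha =>
    hA.eq_zero_of_forall_smul_mem hM.ne_top fun g => by
      rw [← Ideal.Quotient.eq_zero_iff_mem, ← hf, ha]
      rfl
  have hsurj : Function.Surjective f := fun r => by
    obtain ⟨a, ha⟩ := exists_smul_quotient_eq (G := G) hM fun t => r.1 t.out⁻¹
    refine ⟨a, Subtype.ext (funext fun g => ?_)⟩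
    -- The representatives `t.out` are for left cosets, while an element of the induced algebra is
    -- determined on the cosets `S g`; inversion passes from one to the other.
    set t : G ⧸ MulAction.stabilizer G (M : Set A) := QuotientGroup.mk g⁻¹ with ht
    have hs : g * t.out ∈ MulAction.stabilizer G (M : Set A) := by
      have h : (QuotientGroup.mk g⁻¹ : G ⧸ MulAction.stabilizer G (M : Set A)) =
        QuotientGroup.mk t.out := by rw [QuotientGroup.out_eq']
      simpa using QuotientGroup.eq.mp h
    have hg : g = (⟨g * t.out, hs⟩ : MulAction.stabilizer G (M : Set A)).1 * t.out⁻¹ := by simp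
    rw [hg, r.2, (f a).2, hf, ha]
  exact ⟨AlgEquiv.ofBijective f ⟨hinj, hsurj⟩, fun g a => Subtype.ext (funext fun x =>
    congrArg (Ideal.Quotient.mk M) (mul_smul x g a).symm)⟩

/-- The quotient of a Galois algebra by a maximal two-sided ideal is a Galois algebra for the
stabilizer of the ideal. -/
theorem quotient (hA : IsGaloisAlgebra k G A) (hM : IsMaximalTwoSided M) :
    IsGaloisAlgebra k (MulAction.stabilizer G (M : Set A)) (A ⧸ M) where
  faithfullyFlat := by
    have : Nontrivial (A ⧸ M) := Ideal.Quotient.nontrivial_iff.mpr hM.ne_top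
    infer_instance
  invariants := fun b => by
    refine ⟨fun hb => ?_, ?_⟩
    · obtain ⟨f, hf⟩ := hA.isomorphic_inducedAlgebra hM
      -- An invariant of the stabilizer gives a constant function, which is a `G`-invariant of the
      -- induced algebra.
      let r : inducedAlgebra k (MulAction.stabilizer G (M : Set A)) (A ⧸ M) :=
        ⟨fun _ => b, fun s _ => (hb s).symm⟩
      obtain ⟨c, hc⟩ := (hA.invariants (f.symm r)).mp fun g => f.injective (by
        rw [hf, f.apply_symm_apply]; rfl)
      refine ⟨c, ?_⟩
      have h := congrArg f hc
      rw [f.apply_symm_apply, f.commutes] at h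
      exact congrFun (congrArg Subtype.val h) 1
    · rintro ⟨c, rfl⟩ s
      exact smul_algebraMap s c
  can_bijective := by
    have := hA.finiteDimensional
    cases nonempty_fintype G
    classical
    have h := hA.surjective_galoisCanMap_quotient M
    refine ⟨(LinearMap.injective_iff_surjective_of_finrank_eq_finrank ?_).mpr h, h⟩
    rw [Module.finrank_tensorProduct, Module.finrank_pi_fintype, Finset.sum_const,
      Finset.card_univ, smul_eq_mul, ← Nat.card_eq_fintype_card, hA.finrank_quotient_eq_card hM]

/-! ### Equivariant automorphisms and the orbit of the maximal ideal -/

section Automorphisms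

/-- Otherwise the Chinese remainder theorem gives `e ≡ 1` modulo `M` with `g • φ e = φ (g • e)` in
`M` for all `g`. Then `φ e = 0` by `G`-simplicity, so `e = 0`, which is absurd. -/
theorem exists_smul_eq_of_mem_equivariantAut (hA : IsGaloisAlgebra k G A)
    (hM : IsMaximalTwoSided M) (φ : equivariantAut k G A) :
    ∃ g : G, φ • (M : Set A) = g • (M : Set A) := by
  classical
  cases nonempty_fintype G
  by_contra! hcon
  obtain ⟨e, he, he1⟩ := hM.exists_mem_of_forall_ne Finset.univ
    (fun g : G => (MulSemiringAction.toRingEquiv G A g).trans φ.1.toRingEquiv) (fun g _ h => by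
      refine hcon g⁻¹ (Set.ext fun a => ?_)
      rw [Set.mem_inv_smul_set_iff, Set.mem_smul_set_iff_inv_smul_mem]
      have h1 : φ.1 (g • (φ⁻¹ • a)) ∈ M ↔ φ⁻¹ • a ∈ M := h (φ⁻¹ • a)
      have h2 : φ.1 (g • (φ⁻¹ • a)) = g • a := by
        rw [φ.2 g]
        exact congrArg (g • ·) (smul_inv_smul φ a)
      rw [h2] at h1
      exact h1.symm)
  have h0 : φ.1 e = 0 := hA.eq_zero_of_forall_smul_mem hM.ne_top fun g => by
    rw [← φ.2 g]
    exact he g (Finset.mem_univ g)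
  rw [map_eq_zero_iff _ φ.1.injective] at h0
  rw [h0, sub_zero] at he1
  exact hM.ne_top ((Ideal.eq_top_iff_one M).mpr he1)

variable (k) in
/-- The equivariant automorphism of `A ⧸ M` induced by an equivariant automorphism of `A` that
stabilizes `M`. -/
def quotientAut (M : Ideal A) [M.IsTwoSided]
    (τ : MulAction.stabilizer (equivariantAut k G A) (M : Set A)) :
    equivariantAut k (MulAction.stabilizer G (M : Set A)) (A ⧸ M) :=
  ⟨MulSemiringAction.toAlgEquiv k (A ⧸ M) τ, fun s b => by
    obtain ⟨a, rfl⟩ := Ideal.Quotient.mk_surjective b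
    exact congrArg (Ideal.Quotient.mk M) (smul_equivariantAut_comm τ.1 s.1 a)⟩

/-- An element of `A` is determined by the residues of its `G`-translates, and `τ` commutes with
`G`. -/
theorem quotientAut_injective (hA : IsGaloisAlgebra k G A) (hM : M ≠ ⊤) :
    Function.Injective (quotientAut k (G := G) M) := fun τ τ' h => by
  refine Subtype.ext (Subtype.ext (AlgEquiv.ext fun a => sub_eq_zero.mp
    (hA.eq_zero_of_forall_smul_mem hM fun g => ?_)))
  have h1 : Ideal.Quotient.mk M (τ.1 • g • a) = Ideal.Quotient.mk M (τ'.1 • g • a) :=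
    congrArg (fun φ => φ.1 (Ideal.Quotient.mk M (g • a))) h
  rw [smul_equivariantAut_comm, smul_equivariantAut_comm] at h1
  rw [smul_sub]
  exact Ideal.Quotient.eq.mp h1

/-- If `|Aut_G(A)| = |G|` and the simple quotient `A ⧸ M` has at most `|S|` equivariant
automorphisms, where `S` is the stabilizer of `M`, then it has exactly `|S|` of them, and `S` and
the action of `S` on `A ⧸ M` are stable under conjugation. -/
theorem stabilizer_of_card_equivariantAut (hA : IsGaloisAlgebra k G A)
    (hM : IsMaximalTwoSided M) (hcard : Nat.card (equivariantAut k G A) = Nat.card G)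
    (hfin : Finite (equivariantAut k (MulAction.stabilizer G (M : Set A)) (A ⧸ M)))
    (hle : Nat.card (equivariantAut k (MulAction.stabilizer G (M : Set A)) (A ⧸ M)) ≤
      Nat.card (MulAction.stabilizer G (M : Set A))) :
    Nat.card (MulAction.stabilizer G (M : Set A)) ≤
      Nat.card (equivariantAut k (MulAction.stabilizer G (M : Set A)) (A ⧸ M)) ∧
    (MulAction.stabilizer G (M : Set A)).Normal ∧
    ∀ g : G, ∃ ψ : (A ⧸ M) ≃ₐ[k] (A ⧸ M), ∀ s t : MulAction.stabilizer G (M : Set A),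
      t.1 = g * s.1 * g⁻¹ → ∀ b, ψ (s • b) = t • ψ b := by
  have : Finite (equivariantAut k G A) :=
    Nat.finite_of_card_ne_zero (hcard ▸ Nat.card_pos.ne')
  have hsub : MulAction.orbit (equivariantAut k G A) (M : Set A) ⊆
      MulAction.orbit G (M : Set A) := by
    rintro _ ⟨φ, rfl⟩
    obtain ⟨g, hg⟩ := hA.exists_smul_eq_of_mem_equivariantAut hM φ
    exact ⟨g, hg.symm⟩
  have hfinO : (MulAction.orbit G (M : Set A)).Finite := Set.finite_range _
  have h1 := Nat.card_le_card_of_injective _ (hA.quotientAut_injective hM.ne_top)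
  have h2 := (MulAction.stabilizer (equivariantAut k G A) (M : Set A)).card_mul_index
  have h3 := (MulAction.stabilizer G (M : Set A)).card_mul_index
  have h4 := Set.ncard_le_ncard hsub hfinO
  rw [MulAction.index_stabilizer, hcard, ← h3, MulAction.index_stabilizer] at h2
  have hpos : 0 < (MulAction.orbit G (M : Set A)).ncard := by
    rw [← MulAction.index_stabilizer]
    exact Nat.pos_of_ne_zero Subgroup.index_ne_zero_of_finite
  -- By `h2`, stabilizer order times orbit length is the same for both groups. The orbit under
  -- automorphisms is the smaller one, so its stabilizer has order at least `|S|`; the bounds `h1`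
  -- and `hle` turn this into equality, and then the orbits agree.
  have h5 : Nat.card (MulAction.stabilizer G (M : Set A)) ≤
      Nat.card (MulAction.stabilizer (equivariantAut k G A) (M : Set A)) := by
    refine Nat.le_of_mul_le_mul_right ?_ hpos
    rw [← h2]
    exact Nat.mul_le_mul_left _ h4
  have h6 : Nat.card (MulAction.stabilizer G (M : Set A)) =
      Nat.card (MulAction.stabilizer (equivariantAut k G A) (M : Set A)) :=
    le_antisymm h5 (h1.trans hle)
  have horb : MulAction.orbit (equivariantAut k G A) (M : Set A) =
      MulAction.orbit G (M : Set A) := by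
    refine Set.eq_of_subset_of_ncard_le hsub ?_ hfinO
    rw [← h6] at h2
    exact (Nat.eq_of_mul_eq_mul_left Nat.card_pos h2).ge
  -- Since the orbits agree, `g` followed by a suitable `φ` preserves `M`. As `φ` commutes with `G`,
  -- this composite carries the action of `s` to that of `g s g⁻¹`, whence normality of `S` and the
  -- automorphism `ψ`.
  have hex : ∀ g : G, ∃ φ : equivariantAut k G A, ∀ a, φ • g • a ∈ M ↔ a ∈ M := fun g => by
    have hg : g • (M : Set A) ∈ MulAction.orbit (equivariantAut k G A) (M : Set A) :=
      horb ▸ ⟨g, rfl⟩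
    obtain ⟨φ, hφ⟩ := hg
    refine ⟨φ⁻¹, fun a => ?_⟩
    have hφ' : φ • (M : Set A) = g • (M : Set A) := hφ
    have := Set.ext_iff.mp hφ' (g • a)
    rwa [Set.mem_smul_set_iff_inv_smul_mem, Set.smul_mem_smul_set_iff] at this
  refine ⟨h5.trans h1, ⟨fun s hs g => ?_⟩, fun g => ?_⟩
  · obtain ⟨φ, hφ⟩ := hex g
    refine MulAction.mem_stabilizer_set.mpr fun a => ?_
    have e1 := hφ (s • g⁻¹ • φ⁻¹ • a)
    have e2 := hφ (g⁻¹ • φ⁻¹ • a)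
    rw [smul_inv_smul, smul_inv_smul] at e2
    rw [SetLike.mem_coe, SetLike.mem_coe, e2,
      ← M.smul_mem_iff_of_mem_stabilizer hs (a := g⁻¹ • φ⁻¹ • a), ← e1]
    simp only [smul_equivariantAut_comm, smul_inv_smul, mul_smul]
  · obtain ⟨φ, hφ⟩ := hex g
    let f : A ≃ₐ[k] A := (MulSemiringAction.toAlgEquiv k A g).trans φ.1
    have hf : ∀ a, f a = φ • g • a := fun _ => rfl
    refine ⟨Ideal.quotientEquivAlg M M f ?_, fun s t hst b => ?_⟩
    · refine le_antisymm (fun a ha => ?_) (Ideal.map_le_iff_le_comap.mpr fun a ha => (hφ a).mpr ha)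
      rw [← f.apply_symm_apply a]
      refine Ideal.mem_map_of_mem (f : A →+* A) ((hφ _).mp ?_)
      rwa [← hf, f.apply_symm_apply]
    · obtain ⟨a, rfl⟩ := Ideal.Quotient.mk_surjective b
      change Ideal.Quotient.mk M (f (s.1 • a)) = Ideal.Quotient.mk M (t.1 • f a)
      rw [hf, hf, hst, ← smul_equivariantAut_comm, smul_smul, smul_smul, inv_mul_cancel_right]

end Automorphisms

end IsGaloisAlgebra

/-! ### Simple Galois algebras: homogeneous components -/

/-- `u` implements the action of `s` by conjugation: `(s • z) u = u z` for all `z`. -/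
def IsConjugator {S B : Type*} [Group S] [Ring B] [MulSemiringAction S B] (s : S) (u : B) : Prop :=
  ∀ z : B, s • z * u = u * z

namespace IsConjugator

variable {S B : Type*} [Group S] [Ring B] [MulSemiringAction S B]

theorem one : IsConjugator (1 : S) (1 : B) := fun z => by simp

theorem mul {s t : S} {u v : B} (hu : IsConjugator s u) (hv : IsConjugator t v) :
    IsConjugator (s * t) (u * v) := fun z => by
  rw [mul_smul, ← mul_assoc, hu, mul_assoc, hv, mul_assoc]

theorem smul {K : Type*} [Field K] [Algebra K B] {s : S} {u : B} (hu : IsConjugator s u) (α : K) :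
    IsConjugator s (α • u) := fun z => by
  rw [mul_smul_comm, hu, smul_mul_assoc]

theorem map {k : Type*} [Field k] [Algebra k B] {s t : S} {u : B} (hu : IsConjugator s u)
    (φ : B ≃ₐ[k] B) (hφ : ∀ b, φ (s • b) = t • φ b) : IsConjugator t (φ u) := fun z => by
  obtain ⟨w, rfl⟩ := φ.surjective z
  rw [← hφ, ← map_mul, hu, map_mul]

theorem act {s : S} {u : B} (hu : IsConjugator s u) (g : S) :
    IsConjugator (g * s * g⁻¹) (g • u) := fun z => by
  have h := congrArg (g • ·) (hu (g⁻¹ • z))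
  simp only [smul_mul', smul_inv_smul] at h
  rwa [mul_smul, mul_smul]

/-- The left ideal `B u` is two-sided because `u a = (s • a) u`. Simplicity gives a left inverse,
which is two-sided by Dedekind finiteness. -/
theorem isUnit [IsSimpleRing B] [IsDedekindFiniteMonoid B] {s : S} {u : B}
    (hu : IsConjugator s u) (h0 : u ≠ 0) : IsUnit u := by
  let I : TwoSidedIdeal B := TwoSidedIdeal.mk' {b | ∃ z, b = z * u} ⟨0, by simp⟩
    (by rintro _ _ ⟨z, rfl⟩ ⟨w, rfl⟩; exact ⟨z + w, by rw [add_mul]⟩)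
    (by rintro _ ⟨z, rfl⟩; exact ⟨-z, by rw [neg_mul]⟩)
    (by rintro a _ ⟨z, rfl⟩; exact ⟨a * z, by rw [mul_assoc]⟩)
    (by rintro _ a ⟨z, rfl⟩; exact ⟨z * s • a, by rw [mul_assoc, mul_assoc, hu]⟩)
  have hmem : ∀ b, b ∈ I ↔ ∃ z, b = z * u := fun b => TwoSidedIdeal.mem_mk' _ _ _ _ _ _ _
  have hI : I = ⊤ := (eq_bot_or_eq_top I).resolve_left fun h => h0 (by
    have : u ∈ I := (hmem u).mpr ⟨1, by simp⟩
    rw [h] at this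
    exact (TwoSidedIdeal.mem_bot B).mp this)
  obtain ⟨z, hz⟩ := (hmem 1).mp (hI ▸ trivial)
  exact ⟨⟨u, z, mul_eq_one_comm.mp hz.symm, hz.symm⟩, rfl⟩

end IsConjugator

namespace IsGaloisAlgebra

variable {k S B : Type*} [Field k] [Group S] [Fintype S] [Ring B] [Algebra k B]
  [MulSemiringAction S B] [SMulCommClass S k B]

variable (k S B) in
/-- `(b_s)_s` is sent to the endomorphism `y ↦ ∑ s, (s • y) b_s`. -/
def toEnd : (S → B) →ₗ[k] (B →ₗ[k] B) :=
  LinearMap.mk₂ k (fun b y => ∑ s : S, s • y * b s)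
    (by intro b b' y; simp [mul_add, Finset.sum_add_distrib])
    (by intro c b y; simp [Finset.smul_sum])
    (by intro b y y'; simp [add_mul, Finset.sum_add_distrib])
    (by intro c b y; simp [Finset.smul_sum, smul_comm _ c])

theorem toEnd_apply (b : S → B) (y : B) : toEnd k S B b y = ∑ s : S, s • y * b s := rfl

/-- If `∑ (s • y) b_s = 0` for all `y`, multiplying on the left gives `∑ (can t)_s b_s = 0` for
every tensor `t`; take `t` with canonical image the indicator of `s`. -/
theorem toEnd_injective (hB : IsGaloisAlgebra k S B) : Function.Injective (toEnd k S B) := by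
  classical
  refine (injective_iff_map_eq_zero _).mpr fun b hb => funext fun s => ?_
  have key : ∀ t : B ⊗[k] B, ∑ s : S, galoisCanMap k S B t s * b s = 0 := fun t => by
    induction t with
    | zero => simp
    | add t t' h h' => simp only [map_add, Pi.add_apply, add_mul, Finset.sum_add_distrib, h, h',
        add_zero]
    | tmul x y =>
      have h : ∑ s : S, s • y * b s = 0 := by rw [← toEnd_apply (k := k), hb]; rfl
      simp only [galoisCanMap_tmul, mul_assoc]
      rw [← Finset.mul_sum, h, mul_zero]
  obtain ⟨t, ht⟩ := hB.can_bijective.2 (Pi.single s 1)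
  have h := key t
  rw [ht, Finset.sum_eq_single s (by intro t _ hts; simp [Pi.single_eq_of_ne hts]) (by simp)] at h
  simpa using h

theorem toEnd_surjective (hB : IsGaloisAlgebra k S B) : Function.Surjective (toEnd k S B) := by
  have := hB.finiteDimensional
  refine (LinearMap.injective_iff_surjective_of_finrank_eq_finrank ?_).mp hB.toEnd_injective
  rw [Module.finrank_pi_fintype, Finset.sum_const, Finset.card_univ, smul_eq_mul,
    ← Nat.card_eq_fintype_card, Module.finrank_linearMap, hB.finrank_eq_card]

/-- A Galois algebra is the sum of the spaces of its conjugators. -/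
theorem exists_sum_conjugators (hB : IsGaloisAlgebra k S B) (b : B) :
    ∃ c : S → B, (∀ s, IsConjugator s (c s)) ∧ ∑ s, c s = b := by
  obtain ⟨c, hc⟩ := hB.toEnd_surjective (LinearMap.mulLeft k b)
  have hc' : ∀ y, ∑ s : S, s • y * c s = b * y := fun y => by
    rw [← toEnd_apply (k := k), hc, LinearMap.mulLeft_apply]
  refine ⟨c, fun s z => ?_, by simpa using hc' 1⟩
  -- Expanding `b (y z) = (b y) z` in both ways shows that the coefficients `(s • z) c_s` and `c_s
  -- z` define the same endomorphism of `B`.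
  have h : toEnd k S B (fun s => s • z * c s - c s * z) = 0 := by
    ext y
    rw [toEnd_apply, LinearMap.zero_apply]
    have h1 := hc' (y * z)
    rw [← mul_assoc, ← hc' y, Finset.sum_mul] at h1
    simp only [mul_sub, Finset.sum_sub_distrib, ← mul_assoc]
    rw [sub_eq_zero, ← h1]
    simp only [smul_mul']
  have h2 := congrFun ((map_eq_zero_iff _ hB.toEnd_injective).mp h) s
  exact sub_eq_zero.mp h2

/-- For conjugators, `∑ (s • y) c_s = (∑ c_s) y`. -/
theorem eq_zero_of_sum_conjugators (hB : IsGaloisAlgebra k S B) {c : S → B}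
    (hc : ∀ s, IsConjugator s (c s)) (h : ∑ s, c s = 0) : c = 0 := by
  refine (map_eq_zero_iff _ hB.toEnd_injective).mp (LinearMap.ext fun y => ?_)
  rw [toEnd_apply, LinearMap.zero_apply]
  simp only [hc _ y]
  rw [← Finset.sum_mul, h, zero_mul]

end IsGaloisAlgebra

/-! ### Simple Galois algebras: the center -/

/-- Automorphisms preserve the center. The statement is applied to `S`, to the equivariant
automorphisms and to all automorphisms of `B`. -/
theorem exists_gal_of_center {k K B Γ : Type*} [Field k] [Field K] [Algebra k K] [Ring B]
    [Nontrivial B] [Algebra k B] [Algebra K B] [IsScalarTower k K B] [Group Γ]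
    [MulSemiringAction Γ B] [SMulCommClass Γ k B]
    (hK : ∀ b : B, (∀ z, z * b = b * z) → ∃ α : K, algebraMap K B α = b) :
    ∃ f : Γ →* (K ≃ₐ[k] K), ∀ (s : Γ) (α : K),
      s • algebraMap K B α = algebraMap K B (f s α) := by
  have hinj : Function.Injective (algebraMap K B) := (algebraMap K B).injective
  choose c hc using fun (s : Γ) (α : K) => hK (s • algebraMap K B α) fun z => by
    have h := congrArg (s • ·) (Algebra.commutes α (s⁻¹ • z))
    simpa [smul_mul'] using h.symm
  have hmul : ∀ s t α, c (s * t) α = c s (c t α) := fun s t α => hinj (by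
    rw [hc, hc, hc, mul_smul])
  have hone : ∀ α, c 1 α = α := fun α => hinj (by rw [hc, one_smul])
  let e : Γ → (K ≃ₐ[k] K) := fun s =>
    { toFun := c s
      invFun := c s⁻¹
      left_inv := fun α => by rw [← hmul, inv_mul_cancel, hone]
      right_inv := fun α => by rw [← hmul, mul_inv_cancel, hone]
      map_mul' := fun α β => hinj (by rw [hc, map_mul, map_mul, smul_mul', hc, hc])
      map_add' := fun α β => hinj (by rw [hc, map_add, map_add, smul_add, hc, hc])
      commutes' := fun r => hinj (by
        rw [hc, ← IsScalarTower.algebraMap_apply, smul_algebraMap]) }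
  exact ⟨{ toFun := e
           map_one' := AlgEquiv.ext hone
           map_mul' := fun s t => AlgEquiv.ext (hmul s t) }, fun s α => (hc s α).symm⟩

/-- A simple `S`-Galois algebra with center `K`, on which `S` acts through `f`. -/
structure IsCentralGalois {k K S B : Type*} [Field k] [Field K] [Algebra k K] [Group S] [Ring B]
    [Algebra k B] [Algebra K B] [MulSemiringAction S B] [SMulCommClass S k B]
    (f : S →* (K ≃ₐ[k] K)) : Prop where
  isGaloisAlgebra : IsGaloisAlgebra k S B
  isSimpleRing : IsSimpleRing B
  center : ∀ b : B, (∀ z, z * b = b * z) → ∃ α : K, algebraMap K B α = b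
  smul_algebraMap : ∀ (s : S) (α : K), s • algebraMap K B α = algebraMap K B (f s α)

namespace IsCentralGalois

variable {k K S B : Type*} [Field k] [Field K] [Algebra k K] [Group S] [Ring B]
    [Algebra k B] [Algebra K B] [MulSemiringAction S B] [SMulCommClass S k B]
    {f : S →* (K ≃ₐ[k] K)}

theorem smul_smul_eq (h : IsCentralGalois (B := B) f) (s : S) (α : K) (b : B) :
    s • (α • b) = f s α • s • b := by
  rw [Algebra.smul_def, smul_mul', h.smul_algebraMap, ← Algebra.smul_def]

theorem map_eq_one (h : IsCentralGalois (B := B) f) {s : S} {u : B} (hu : IsConjugator s u)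
    (h0 : u ≠ 0) : f s = 1 := by
  ext α
  have h1 := hu (algebraMap K B α)
  rw [h.smul_algebraMap, ← Algebra.commutes, ← sub_eq_zero, ← sub_mul, ← map_sub,
    ← Algebra.smul_def, smul_eq_zero] at h1
  exact sub_eq_zero.mp (h1.resolve_right h0)

variable [Finite S]

theorem isUnit (h : IsCentralGalois (B := B) f) {s : S} {u : B}
    (hu : IsConjugator s u) (h0 : u ≠ 0) : IsUnit u := by
  have := h.isSimpleRing
  have := h.isGaloisAlgebra.finiteDimensional
  have : IsNoetherianRing B := isNoetherian_of_tower k inferInstance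
  exact hu.isUnit h0

/-- The quotient `v u⁻¹` commutes with every element of `B`. -/
theorem exists_smul_eq (h : IsCentralGalois (B := B) f) {s : S} {u v : B} (hu : IsConjugator s u)
    (h0 : u ≠ 0) (hv : IsConjugator s v) : ∃ α : K, v = α • u := by
  obtain ⟨w, rfl⟩ := h.isUnit hu h0
  obtain ⟨α, hα⟩ := h.center (v * ↑w⁻¹) fun z => by
    have h1 : (s • (s⁻¹ • z)) * v = v * (s⁻¹ • z) := hv _
    have h2 : (s • (s⁻¹ • z)) * w = w * (s⁻¹ • z) := hu _
    rw [smul_inv_smul] at h1 h2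
    have h3 : s⁻¹ • z = ↑w⁻¹ * z * w := by rw [mul_assoc, h2, Units.inv_mul_cancel_left]
    rw [← mul_assoc, h1, h3, mul_assoc, Units.mul_inv_cancel_right, mul_assoc]
  refine ⟨α, ?_⟩
  rw [Algebra.smul_def, hα, Units.inv_mul_cancel_right]

variable [IsScalarTower k K B]

theorem finiteDimensional_center (h : IsCentralGalois (B := B) f) : FiniteDimensional k K := by
  have := h.isGaloisAlgebra.nontrivial
  have := h.isGaloisAlgebra.finiteDimensional
  exact FiniteDimensional.of_injective (IsScalarTower.toAlgHom k K B).toLinearMap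
    (algebraMap K B).injective

/-- The invariants of `B` are `k`, so the image of `f` has fixed field `k`. -/
theorem surjective (h : IsCentralGalois (B := B) f) : Function.Surjective f := by
  have := h.isGaloisAlgebra.nontrivial
  have := h.finiteDimensional_center
  have hfix : IntermediateField.fixedField f.range = ⊥ := by
    rw [eq_bot_iff]
    intro α hα
    rw [IntermediateField.mem_fixedField_iff] at hα
    obtain ⟨c, hc⟩ := (h.isGaloisAlgebra.invariants (algebraMap K B α)).mp fun s => by
      rw [h.smul_algebraMap, hα _ ⟨s, rfl⟩]
    refine IntermediateField.mem_bot.mpr ⟨c, (algebraMap K B).injective ?_⟩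
    rw [← hc, ← IsScalarTower.algebraMap_apply]
  rw [← MonoidHom.range_eq_top, ← IntermediateField.fixingSubgroup_fixedField f.range, hfix,
    IntermediateField.fixingSubgroup_bot]

theorem card_ker_mul [IsGalois k K] (h : IsCentralGalois (B := B) f) :
    Nat.card f.ker * Nat.card (K ≃ₐ[k] K) = Nat.card S := by
  rw [← f.ker.card_mul_index, Subgroup.index_ker, MonoidHom.range_eq_top.mpr h.surjective,
    Subgroup.card_top]

end IsCentralGalois

namespace IsCentralGalois

variable {k K S B : Type*} [Field k] [Field K] [Algebra k K] [Group S] [Finite S] [Ring B]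
    [Algebra k B] [Algebra K B] [MulSemiringAction S B] [SMulCommClass S k B]
    {f : S →* (K ≃ₐ[k] K)}

/-- With the next lemma: conjugators, one for each element of the kernel, form a `K`-basis of `B`.
The map `j` allows the kernel to be indexed by `f.ker` or by a subgroup of `G`. -/
theorem exists_sum_smul {ι : Type*} [Fintype ι] {j : ι → S} (hj : Function.Injective j)
    (hr : ∀ s, f s = 1 → s ∈ Set.range j) (h : IsCentralGalois (B := B) f) {u : ι → B}
    (hu0 : ∀ x, u x ≠ 0) (hu : ∀ x, IsConjugator (j x) (u x)) (b : B) :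
    ∃ α : ι → K, b = ∑ x, α x • u x := by
  cases nonempty_fintype S
  obtain ⟨c, hc, rfl⟩ := h.isGaloisAlgebra.exists_sum_conjugators b
  choose α hα using fun x => h.exists_smul_eq (hu x) (hu0 x) (hc (j x))
  refine ⟨α, (Fintype.sum_of_injective j hj _ _ (fun s hs => ?_) fun x => (hα x).symm).symm⟩
  by_contra h0
  exact hs (hr s (h.map_eq_one (hc s) h0))

theorem eq_zero_of_sum_smul {ι : Type*} [Fintype ι] {j : ι → S} (hj : Function.Injective j)
    (h : IsCentralGalois (B := B) f) {u : ι → B}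
    (hu0 : ∀ x, u x ≠ 0) (hu : ∀ x, IsConjugator (j x) (u x)) {α : ι → K}
    (h0 : ∑ x, α x • u x = 0) : α = 0 := by
  classical
  cases nonempty_fintype S
  let c : S → B := Function.extend j (fun x => α x • u x) 0
  have hcx : ∀ x, c (j x) = α x • u x := fun x => hj.extend_apply _ _ x
  have hcn : ∀ s, s ∉ Set.range j → c s = 0 := fun s hs => Function.extend_apply' _ _ s hs
  have hc : ∀ s, IsConjugator s (c s) := fun s => by
    by_cases hs : s ∈ Set.range j
    · obtain ⟨x, rfl⟩ := hs
      rw [hcx]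
      exact (hu x).smul _
    · rw [hcn s hs]
      intro z
      simp
  have hsum : ∑ s, c s = 0 := by
    rw [← h0]
    exact (Fintype.sum_of_injective j hj _ _ hcn fun x => (hcx x).symm).symm
  have h1 := h.isGaloisAlgebra.eq_zero_of_sum_conjugators hc hsum
  funext x
  have h2 := congrFun h1 (j x)
  rw [hcx] at h2
  exact (smul_eq_zero.mp h2).resolve_right (hu0 x)

variable [IsScalarTower k K B]

/-- The elements acting trivially on the center act by inner automorphisms. -/
theorem exists_conjugator [IsGalois k K] (h : IsCentralGalois (B := B) f) (x : f.ker) :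
    ∃ u : B, u ≠ 0 ∧ IsConjugator x.1 u := by
  classical
  cases nonempty_fintype S
  have := h.isGaloisAlgebra.finiteDimensional
  have := h.finiteDimensional_center
  have : FiniteDimensional K B := FiniteDimensional.right k K B
  -- The value `0` stands for the absence of a nonzero conjugator; in all cases `v s` spans the
  -- conjugators of `s`.
  let v : S → B := fun s => if hs : ∃ u : B, u ≠ 0 ∧ IsConjugator s u then hs.choose else 0
  have hv : ∀ s (c : B), IsConjugator s c → ∃ α : K, c = α • v s := fun s c hc => by
    by_cases hc0 : c = 0
    · exact ⟨0, by simp [hc0]⟩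
    · have hs : ∃ u : B, u ≠ 0 ∧ IsConjugator s u := ⟨c, hc0, hc⟩
      have hvs : v s = hs.choose := dif_pos hs
      rw [hvs]
      exact h.exists_smul_eq hs.choose_spec.2 hs.choose_spec.1 hc
  let F : Finset S := Finset.univ.filter fun s => v s ≠ 0
  have hspan : Submodule.span K ((F.image v : Finset B) : Set B) = ⊤ := by
    rw [eq_top_iff]
    intro b _
    obtain ⟨c, hc, rfl⟩ := h.isGaloisAlgebra.exists_sum_conjugators b
    refine Submodule.sum_mem _ fun s _ => ?_
    obtain ⟨α, hα⟩ := hv s (c s) (hc s)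
    rw [hα]
    by_cases hs : v s = 0
    · rw [hs, smul_zero]
      exact Submodule.zero_mem _
    · exact Submodule.smul_mem _ _ (Submodule.subset_span
        (Finset.mem_coe.mpr (Finset.mem_image_of_mem v (by simpa [F] using hs))))
  have hker : ∀ s ∈ F, ∃ u : B, u ≠ 0 ∧ IsConjugator s u := fun s hs => by
    by_contra hcon
    exact (Finset.mem_filter.mp hs).2 (dif_neg hcon)
  let N : Finset S := Finset.univ.filter (· ∈ f.ker)
  have hN : N.card = Nat.card f.ker := by
    rw [Nat.card_eq_fintype_card, Fintype.card_subtype]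
  have hFN : F ⊆ N := fun s hs => by
    obtain ⟨u, hu0, hu⟩ := hker s hs
    exact Finset.mem_filter.mpr ⟨Finset.mem_univ s, h.map_eq_one hu hu0⟩
  -- The nonzero `v s` are indexed by `F ⊆ f.ker` and span `B`, while `dim_K B = |S| / [K : k] =
  -- |f.ker|`; so `F` is the whole kernel.
  have h1 : Module.finrank K B ≤ F.card := by
    rw [← finrank_top K B, ← hspan]
    exact (finrank_span_finset_le_card _).trans Finset.card_image_le
  have h2 : Module.finrank k K * Module.finrank K B = Nat.card S := by
    rw [Module.finrank_mul_finrank, h.isGaloisAlgebra.finrank_eq_card]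
  rw [← h.card_ker_mul, IsGalois.card_aut_eq_finrank, mul_comm] at h2
  have h3 := Nat.eq_of_mul_eq_mul_right Module.finrank_pos h2
  have h4 : F = N := Finset.eq_of_subset_of_card_le hFN (by rw [hN, ← h3]; exact h1)
  exact hker x.1 (by rw [h4]; exact Finset.mem_filter.mpr ⟨Finset.mem_univ _, x.2⟩)

end IsCentralGalois

/-! ### Counting characters and equivariant automorphisms -/

section Characters

variable {K N ι : Type*} [Field K] [Group N] [Finite N] {χ : ι → N →* K}

/-- Dedekind: distinct characters are linearly independent functions on `N`. -/
theorem finite_of_injective_characters (hχ : Function.Injective χ) :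
    Finite ι ∧ Nat.card ι ≤ Nat.card N := by
  cases nonempty_fintype N
  have hli := (linearIndependent_monoidHom N K).comp χ hχ
  have := hli.finite
  cases nonempty_fintype ι
  refine ⟨this, ?_⟩
  have h := hli.fintype_card_le_finrank
  rwa [Module.finrank_pi, ← Nat.card_eq_fintype_card, ← Nat.card_eq_fintype_card] at h

/-- With `|N|` characters one has a basis of the functions on `N`, so the indicator of `x` is a
combination of functions agreeing at `x` and `y`. -/
theorem eq_of_forall_character_eq (hχ : Function.Injective χ) (hcard : Nat.card N ≤ Nat.card ι)
    {x y : N} (hxy : ∀ i, χ i x = χ i y) : x = y := by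
  classical
  cases nonempty_fintype N
  have hli := (linearIndependent_monoidHom N K).comp χ hχ
  have := hli.finite
  cases nonempty_fintype ι
  have hspan := hli.span_eq_top_of_card_eq_finrank' (le_antisymm hli.fintype_card_le_finrank (by
    rwa [Module.finrank_pi, ← Nat.card_eq_fintype_card, ← Nat.card_eq_fintype_card]))
  by_contra hne
  have hmem : (Pi.single x 1 : N → K) ∈ Submodule.span K
      (Set.range ((fun f => f : (N →* K) → N → K) ∘ χ)) := by
    rw [hspan]
    trivial
  have hle : Submodule.span K (Set.range ((fun f => f : (N →* K) → N → K) ∘ χ)) ≤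
      LinearMap.ker (LinearMap.proj (R := K) (φ := fun _ : N => K) x - LinearMap.proj y) := by
    rw [Submodule.span_le]
    rintro _ ⟨i, rfl⟩
    simp [hxy i]
  have h := hle hmem
  simp [Pi.single_eq_of_ne (Ne.symm hne)] at h

end Characters

namespace IsCentralGalois

variable {k K S B : Type*} [Field k] [Field K] [Algebra k K] [Group S] [Finite S] [Ring B]
    [Algebra k B] [Algebra K B] [IsScalarTower k K B] [MulSemiringAction S B] [SMulCommClass S k B]
    {f : S →* (K ≃ₐ[k] K)}

/-- An equivariant automorphism that is trivial on the center is given by a character. -/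
theorem exists_character [IsGalois k K] (h : IsCentralGalois (B := B) f)
    {φ : B ≃ₐ[k] B} (hφ : φ ∈ equivariantAut k S B)
    (hlin : ∀ α : K, φ (algebraMap K B α) = algebraMap K B α) :
    ∃ χ : f.ker →* K, (∀ (x : f.ker) (v : B), IsConjugator x.1 v → φ v = χ x • v) ∧
      ∀ (g : S) (x y : f.ker), y.1 = g * x.1 * g⁻¹ → χ y = f g (χ x) := by
  have := h.isGaloisAlgebra.nontrivial
  choose u hu0 hu using h.exists_conjugator
  have hsmul : ∀ (α : K) (b : B), φ (α • b) = α • φ b := fun α b => by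
    rw [Algebra.smul_def, map_mul, hlin, ← Algebra.smul_def]
  choose χ hχ using fun x => h.exists_smul_eq (hu x) (hu0 x) ((hu x).map φ fun b => hφ x.1 b)
  have hχ' : ∀ (x : f.ker) (v : B), IsConjugator x.1 v → φ v = χ x • v := fun x v hv => by
    obtain ⟨α, rfl⟩ := h.exists_smul_eq (hu x) (hu0 x) hv
    rw [hsmul, hχ, smul_comm]
  have hinj : ∀ {x : f.ker} {v : B} {α β : K}, IsConjugator x.1 v → v ≠ 0 → α • v = β • v →
      α = β := fun _ h0 he => smul_left_injective K h0 he
  have hmul : ∀ x y, χ (x * y) = χ x * χ y := fun x y => by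
    have hne : u x * u y ≠ 0 := ((h.isUnit (hu x) (hu0 x)).mul (h.isUnit (hu y) (hu0 y))).ne_zero
    refine hinj (x := x * y) ((hu x).mul (hu y)) hne ?_
    rw [← hχ' (x * y) _ ((hu x).mul (hu y)), map_mul, hχ, hχ, smul_mul_smul_comm]
  have hone : χ 1 = 1 := by
    refine hinj (x := 1) IsConjugator.one one_ne_zero ?_
    rw [← hχ' 1 1 IsConjugator.one, map_one, one_smul]
  refine ⟨⟨⟨χ, hone⟩, hmul⟩, hχ', fun g x y hxy => ?_⟩
  have hgu : IsConjugator y.1 (g • u x) := hxy ▸ (hu x).act g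
  have hne : g • u x ≠ 0 := fun h0 => hu0 x ((smul_eq_zero_iff_eq g).mp h0)
  refine hinj hgu hne ?_
  change χ y • g • u x = f g (χ x) • g • u x
  rw [← hχ' y _ hgu, hφ, hχ, h.smul_smul_eq]

/-- An automorphism in the kernel of restriction to the center is determined by its character,
because the conjugators span `B`. The character lemmas then bound the kernel and describe the
extremal case. -/
theorem exists_restriction [IsGalois k K] (h : IsCentralGalois (B := B) f) :
    ∃ ρ : equivariantAut k S B →* (K ≃ₐ[k] K),
      (∀ φ α, φ.1 (algebraMap K B α) = algebraMap K B (ρ φ α)) ∧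
      Finite ρ.ker ∧ Nat.card ρ.ker ≤ Nat.card f.ker ∧
      (Nat.card f.ker ≤ Nat.card ρ.ker → ∀ x y : f.ker, (∀ χ : f.ker →* K,
        (∀ (g : S) (x y : f.ker), y.1 = g * x.1 * g⁻¹ → χ y = f g (χ x)) → χ x = χ y) →
          x = y) := by
  have := h.isGaloisAlgebra.nontrivial
  obtain ⟨ρ, hρ⟩ := exists_gal_of_center (k := k) (Γ := equivariantAut k S B) h.center
  have hρ' : ∀ φ α, φ.1 (algebraMap K B α) = algebraMap K B (ρ φ α) := hρ
  choose χ hχ hχg using fun φ : ρ.ker => h.exists_character φ.1.2 fun α => by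
    rw [hρ', show ρ φ.1 = 1 from φ.2]
    rfl
  have hinj : Function.Injective χ := fun φ φ' he => by
    cases nonempty_fintype f.ker
    choose u hu0 hu using h.exists_conjugator
    refine Subtype.ext (Subtype.ext (AlgEquiv.ext fun b => ?_))
    obtain ⟨α, rfl⟩ := h.exists_sum_smul (ι := f.ker) (j := Subtype.val)
      Subtype.val_injective (fun s hs => ⟨⟨s, hs⟩, rfl⟩) hu0 hu b
    simp only [map_sum]
    refine Finset.sum_congr rfl fun x _ => ?_
    rw [hχ φ x _ ((hu x).smul _), hχ φ' x _ ((hu x).smul _), he]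
  obtain ⟨hfin, hle⟩ := finite_of_injective_characters hinj
  exact ⟨ρ, hρ', hfin, hle, fun hc x y hxy =>
    eq_of_forall_character_eq hinj hc fun φ => hxy _ (hχg φ)⟩

theorem finite_equivariantAut [IsGalois k K] (h : IsCentralGalois (B := B) f) :
    Finite (equivariantAut k S B) := by
  have := h.finiteDimensional_center
  obtain ⟨ρ, -, hfin, -⟩ := h.exists_restriction
  refine Nat.finite_of_card_ne_zero ?_
  rw [← ρ.ker.card_mul_index, Subgroup.index_ker]
  exact mul_ne_zero Nat.card_pos.ne' Nat.card_pos.ne'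

theorem card_equivariantAut_le [IsGalois k K] (h : IsCentralGalois (B := B) f) :
    Nat.card (equivariantAut k S B) ≤ Nat.card S := by
  have := h.finiteDimensional_center
  obtain ⟨ρ, -, hfin, hle, -⟩ := h.exists_restriction
  rw [← h.card_ker_mul, ← ρ.ker.card_mul_index, Subgroup.index_ker]
  exact Nat.mul_le_mul hle (Subgroup.card_le_card_group _)

/-- The order of `Aut_S(B)` is a product of two factors bounded by `|f.ker|` and `|Gal(K|k)|`, with
product `|S|`; both bounds must be attained. -/
theorem of_card_le_card_equivariantAut [IsGalois k K] (h : IsCentralGalois (B := B) f)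
    (hcard : Nat.card S ≤ Nat.card (equivariantAut k S B)) :
    (∀ ω : K ≃ₐ[k] K, ∃ φ ∈ equivariantAut k S B,
      ∀ α, φ (algebraMap K B α) = algebraMap K B (ω α)) ∧
    ∀ x y : f.ker, (∀ χ : f.ker →* K,
      (∀ (g : S) (x y : f.ker), y.1 = g * x.1 * g⁻¹ → χ y = f g (χ x)) → χ x = χ y) → x = y := by
  have := h.finiteDimensional_center
  obtain ⟨ρ, hρ, hfin, hle, hsep⟩ := h.exists_restriction
  rw [← h.card_ker_mul, ← ρ.ker.card_mul_index, Subgroup.index_ker] at hcard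
  have hr := Subgroup.card_le_card_group ρ.range
  have h1 : Nat.card f.ker ≤ Nat.card ρ.ker :=
    Nat.le_of_mul_le_mul_right (hcard.trans (Nat.mul_le_mul_left _ hr)) Nat.card_pos
  have h2 : Nat.card (K ≃ₐ[k] K) ≤ Nat.card ρ.range :=
    Nat.le_of_mul_le_mul_left (hcard.trans (Nat.mul_le_mul_right _ hle)) Nat.card_pos
  refine ⟨fun ω => ?_, hsep h1⟩
  obtain ⟨φ, rfl⟩ := (Subgroup.eq_top_of_le_card _ h2 ▸ Subgroup.mem_top ω : ω ∈ ρ.range)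
  exact ⟨φ.1, φ.2, hρ φ⟩

end IsCentralGalois

/-! ### The twisted group algebra structure of a simple Galois algebra -/

/-- The sum of conjugator spaces is direct, and otherwise `v` in degree `s` and `-v` in degree `t`
would sum to zero. -/
theorem IsGaloisAlgebra.eq_of_isConjugator {k S B : Type*} [Field k] [Group S] [Finite S] [Ring B]
    [Algebra k B] [MulSemiringAction S B] [SMulCommClass S k B] (hB : IsGaloisAlgebra k S B)
    {s t : S} {v : B} (hs : IsConjugator s v) (ht : IsConjugator t v) (h0 : v ≠ 0) : s = t := by
  classical
  cases nonempty_fintype S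
  by_contra hne
  have hsingle : ∀ r : S, IsConjugator r v → ∀ x, IsConjugator x (Pi.single (M := fun _ => B) r v x) :=
    fun r hr x => by
      by_cases hx : x = r
      · subst hx
        rwa [Pi.single_eq_same]
      · rw [Pi.single_eq_of_ne hx]
        intro z
        simp
  have h := hB.eq_zero_of_sum_conjugators (c := Pi.single s v - Pi.single t v)
    (fun x z => by
      rw [Pi.sub_apply, mul_sub, sub_mul, hsingle s hs x, hsingle t ht x])
    (by simp [Finset.sum_sub_distrib])
  have h1 := congrFun h s
  rw [Pi.sub_apply, Pi.single_eq_same, Pi.single_eq_of_ne hne, sub_zero] at h1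
  exact h0 h1

theorem IsGaloisAlgebra.eq_one_of_forall_smul_eq {k S B : Type*} [Field k] [Group S] [Finite S]
    [Ring B] [Algebra k B] [MulSemiringAction S B] [SMulCommClass S k B]
    (hB : IsGaloisAlgebra k S B) {s : S} (hs : ∀ b : B, s • b = b) : s = 1 := by
  have := hB.nontrivial
  exact hB.eq_of_isConjugator (v := 1) (fun z => by simp [hs]) IsConjugator.one one_ne_zero

namespace IsCentralGalois

variable {k K S B : Type*} [Field k] [Field K] [Algebra k K] [Group S] [Ring B]
    [Algebra k B] [Algebra K B] [MulSemiringAction S B] [SMulCommClass S k B]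
    {f : S →* (K ≃ₐ[k] K)}

theorem smul_apply_of_map_eq_one (h : IsCentralGalois (B := B) f) {s : S} (hs : f s = 1) (α : K)
    (b : B) : s • (α • b) = α • s • b := by
  rw [h.smul_smul_eq, hs, AlgEquiv.one_apply]

variable [Finite S]

theorem exists_unit_smul_eq (h : IsCentralGalois (B := B) f) {s : S} {u v : B}
    (hu : IsConjugator s u) (hu0 : u ≠ 0) (hv : IsConjugator s v) (hv0 : v ≠ 0) :
    ∃ α : Kˣ, v = (α : K) • u := by
  obtain ⟨α, hα⟩ := h.exists_smul_eq hu hu0 hv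
  have h0 : α ≠ 0 := by
    rintro rfl
    exact hv0 (by rw [hα, zero_smul])
  exact ⟨Units.mk0 α h0, hα⟩

theorem mul_ne_zero (h : IsCentralGalois (B := B) f) {s t : S} {u v : B}
    (hu : IsConjugator s u) (hu0 : u ≠ 0) (hv : IsConjugator t v) (hv0 : v ≠ 0) : u * v ≠ 0 := by
  have := h.isGaloisAlgebra.nontrivial
  exact ((h.isUnit hu hu0).mul (h.isUnit hv hv0)).ne_zero

variable {N : Type*} [Group N] {j : N →* S} {u : N → B}

/-- Both `u x * u y` and `u (x * y)` are conjugators of `x y`, so they differ by a scalar;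
associativity is the cocycle identity, and `u 1 = 1` normalizes it. -/
theorem exists_twoCocycle (h : IsCentralGalois (B := B) f) (hu0 : ∀ x, u x ≠ 0)
    (hu : ∀ x, IsConjugator (j x) (u x)) (hu1 : u 1 = 1) :
    ∃ σ : TwoCocycle N Kˣ, ∀ x y, u x * u y = (σ x y : K) • u (x * y) := by
  choose σ hσ using fun x y => h.exists_unit_smul_eq (hu (x * y)) (hu0 _)
    (map_mul j x y ▸ (hu x).mul (hu y)) (h.mul_ne_zero (hu x) (hu0 x) (hu y) (hu0 y))
  have hinj : ∀ {x : N} {α β : Kˣ}, (α : K) • u x = (β : K) • u x → α = β := fun he =>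
    Units.ext (smul_left_injective K (hu0 _) he)
  refine ⟨⟨σ, fun x => ?_, fun x => ?_, fun x y z => ?_⟩, hσ⟩
  · have := hσ 1 x
    rw [hu1, one_mul, one_mul] at this
    exact hinj (x := x) (by rw [← this, Units.val_one, one_smul])
  · have := hσ x 1
    rw [hu1, mul_one, mul_one] at this
    exact hinj (x := x) (by rw [← this, Units.val_one, one_smul])
  · have h1 := mul_assoc (u x) (u y) (u z)
    rw [hσ, hσ, smul_mul_assoc, mul_smul_comm, hσ, hσ, smul_smul, smul_smul, mul_assoc x y z] at h1
    exact hinj (by rw [Units.val_mul, Units.val_mul]; exact h1)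

variable {σ : TwoCocycle N Kˣ}

theorem smul_eq_alt (h : IsCentralGalois (B := B) f) (hu0 : ∀ x, u x ≠ 0)
    (hu : ∀ x, IsConjugator (j x) (u x)) (hσ : ∀ x y, u x * u y = (σ x y : K) • u (x * y))
    {x y : N} (hxy : x * y = y * x) : j x • u y = (σ.alt x y : K) • u y := by
  have h1 := hu x (u y)
  refine (h.isUnit (hu x) (hu0 x)).mul_left_injective ?_
  change j x • u y * u x = (σ.alt x y : K) • u y * u x
  rw [h1, hσ, smul_mul_assoc, hσ, smul_smul, hxy, TwoCocycle.alt, ← Units.val_mul, div_mul_cancel]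

/-- A regular element fixes every `u y`, hence acts trivially on `B`, and the action is faithful. -/
theorem isNondegenerate (h : IsCentralGalois (B := B) f) [Finite N] (hj : Function.Injective j)
    (hr : ∀ s, f s = 1 → s ∈ Set.range j) (hjf : ∀ x, f (j x) = 1) (hu0 : ∀ x, u x ≠ 0)
    (hu : ∀ x, IsConjugator (j x) (u x)) (hσ : ∀ x y, u x * u y = (σ x y : K) • u (x * y))
    (hN : ∀ x y : N, x * y = y * x) : σ.IsNondegenerate := fun s hs => by
  cases nonempty_fintype N
  apply hj
  rw [map_one]
  refine h.isGaloisAlgebra.eq_one_of_forall_smul_eq fun b => ?_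
  obtain ⟨α, rfl⟩ := h.exists_sum_smul hj hr hu0 hu b
  rw [Finset.smul_sum]
  refine Finset.sum_congr rfl fun y _ => ?_
  rw [h.smul_apply_of_map_eq_one (hjf s), h.smul_eq_alt hu0 hu hσ (hN s y), TwoCocycle.alt,
    hs y (hN s y), div_self', Units.val_one, one_smul]

/-- Automorphisms compatible with conjugation change `σ` by a coboundary. -/
theorem exists_coboundary (h : IsCentralGalois (B := B) f) (hu0 : ∀ x, u x ≠ 0)
    (hu : ∀ x, IsConjugator (j x) (u x)) (hu1 : u 1 = 1)
    (hσ : ∀ x y, u x * u y = (σ x y : K) • u (x * y))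
    (ψ : B ≃ₐ[k] B) (hψ : ∀ α : K, ψ (algebraMap K B α) = algebraMap K B α) (c : N →* N)
    (hc : ∀ x b, ψ (j x • b) = j (c x) • ψ b) :
    ∃ η : N → Kˣ, (∀ x, u (c x) = (η x : K) • ψ (u x)) ∧ η 1 = 1 ∧
      ∀ x y, σ (c x) (c y) = σ x y * (η y * η x / η (x * y)) := by
  have hψ0 : ∀ x, ψ (u x) ≠ 0 := fun x => by simpa using hu0 x
  have hψs : ∀ (α : K) b, ψ (α • b) = α • ψ b := fun α b => by
    rw [Algebra.smul_def, map_mul, hψ, ← Algebra.smul_def]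
  choose η hη using fun x => h.exists_unit_smul_eq ((hu x).map ψ (hc x)) (hψ0 x) (hu (c x)) (hu0 _)
  refine ⟨η, hη, ?_, fun x y => ?_⟩
  · have h1 := hη 1
    rw [map_one, hu1, map_one] at h1
    have := h.isGaloisAlgebra.nontrivial
    exact Units.ext (smul_left_injective K (one_ne_zero' B) (by
      change (η 1 : K) • (1 : B) = ((1 : Kˣ) : K) • 1
      rw [← h1, Units.val_one, one_smul]))
  · have h1 := hσ (c x) (c y)
    rw [← map_mul c, hη, hη, hη, smul_mul_smul_comm, ← map_mul, hσ, hψs, smul_smul, smul_smul] at h1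
    have h2 := smul_left_injective K (hψ0 _) h1
    rw [← mul_div_assoc, eq_div_iff_mul_eq']
    apply Units.ext
    push_cast
    linear_combination -h2

end IsCentralGalois

/-! ### Conjugators with square `±1` -/

section Signs

variable {K N B : Type*} [Field K] [Group N] [Ring B] [Algebra K B] {u : N → B}
  {σ : TwoCocycle N Kˣ}

theorem exists_sign_of_sq {v : B} (hv : v * v = 1 ∨ v * v = -1) :
    ∃ ε : K, (ε = 1 ∨ ε = -1) ∧ v * v = ε • 1 := by
  rcases hv with hv | hv
  · exact ⟨1, Or.inl rfl, by rw [hv, one_smul]⟩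
  · exact ⟨-1, Or.inr rfl, by rw [hv, neg_smul, one_smul]⟩

variable [Nontrivial B]

/-- The square of `u x * u y` is `σ(x,y) ^ 2` times a sign, and also `Alt(σ)(x,y)` times a product
of two signs. -/
theorem TwoCocycle.sq_eq_one_or_neg_one (hσ : ∀ x y, u x * u y = (σ x y : K) • u (x * y))
    (hsq : ∀ x, u x * u x = 1 ∨ u x * u x = -1) (hN : ∀ x y : N, x * y = y * x)
    (halt : ∀ x y, (σ.alt x y : K) ^ 2 = 1) (x y : N) :
    (σ x y : K) ^ 2 = 1 ∨ (σ x y : K) ^ 2 = -1 := by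
  have hyx : u x * u y = (σ.alt x y : K) • (u y * u x) := by
    rw [hσ, hσ, smul_smul, hN x y, TwoCocycle.alt, ← Units.val_mul, div_mul_cancel]
  obtain ⟨a, ha, hax⟩ := exists_sign_of_sq (K := K) (hsq x)
  obtain ⟨b, hb, hby⟩ := exists_sign_of_sq (K := K) (hsq y)
  obtain ⟨c, hc, hcxy⟩ := exists_sign_of_sq (K := K) (hsq (x * y))
  have h1 : (u x * u y) * (u x * u y) = ((σ.alt x y : K) * (a * b)) • 1 := by
    nth_rewrite 1 [hyx]
    rw [smul_mul_assoc, mul_assoc, ← mul_assoc (u x), hax, smul_mul_assoc, one_mul, mul_smul_comm,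
      hby, smul_smul, smul_smul, mul_assoc]
  rw [hσ, smul_mul_smul_comm, hcxy, smul_smul] at h1
  have h2 := smul_left_injective K (one_ne_zero' B) h1
  rcases sq_eq_sq_iff_eq_or_eq_neg.mp ((halt x y).trans (one_pow 2).symm) with hd | hd <;>
  rcases ha with rfl | rfl <;> rcases hb with rfl | rfl <;> rcases hc with rfl | rfl <;>
  rw [hd] at h2 <;>
  first
  | (left; linear_combination h2)
  | (left; linear_combination -h2)
  | (right; linear_combination h2)
  | (right; linear_combination -h2)

theorem sq_eq_one_or_neg_one_of_smul {v w : B} (hv : v * v = 1 ∨ v * v = -1)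
    (hw : w * w = 1 ∨ w * w = -1) {α : K} (hvw : v = α • w) : α ^ 2 = 1 ∨ α ^ 2 = -1 := by
  obtain ⟨a, ha, hav⟩ := exists_sign_of_sq (K := K) hv
  obtain ⟨b, hb, hbw⟩ := exists_sign_of_sq (K := K) hw
  rw [hvw, smul_mul_smul_comm, hbw, smul_smul] at hav
  have h2 := smul_left_injective K (one_ne_zero' B) hav
  rcases ha with rfl | rfl <;> rcases hb with rfl | rfl <;>
  first
  | (left; linear_combination h2)
  | (left; linear_combination -h2)
  | (right; linear_combination h2)
  | (right; linear_combination -h2)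

end Signs

/-! ### Comparison with induced algebras of Galois data -/

section Comparison

variable {k G : Type*} [Field k] [Group G]

theorem GAlgIsomorphic.trans {A B C : Type*} [Ring A] [Algebra k A] [MulSemiringAction G A]
    [Ring B] [Algebra k B] [MulSemiringAction G B] [Ring C] [Algebra k C] [MulSemiringAction G C]
    (h : GAlgIsomorphic k G A B) (h' : GAlgIsomorphic k G B C) : GAlgIsomorphic k G A C := by
  obtain ⟨e, he⟩ := h
  obtain ⟨e', he'⟩ := h'
  exact ⟨e.trans e', fun g a => by rw [AlgEquiv.trans_apply, he, he', AlgEquiv.trans_apply]⟩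

theorem GAlgIsomorphic.symm {A B : Type*} [Ring A] [Algebra k A] [MulSemiringAction G A]
    [Ring B] [Algebra k B] [MulSemiringAction G B] (h : GAlgIsomorphic k G A B) :
    GAlgIsomorphic k G B A := by
  obtain ⟨e, he⟩ := h
  exact ⟨e.symm, fun g b => e.injective (by rw [he, e.apply_symm_apply, e.apply_symm_apply])⟩

theorem GAlgIsomorphic.induced {S : Subgroup G} {B C : Type*} [Ring B] [Algebra k B]
    [MulSemiringAction S B] [SMulCommClass S k B] [Ring C] [Algebra k C] [MulSemiringAction S C]
    [SMulCommClass S k C] (h : GAlgIsomorphic k S B C) :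
    GAlgIsomorphic k G (inducedAlgebra k S B) (inducedAlgebra k S C) := by
  obtain ⟨e, he⟩ := h
  have he' : ∀ (s : S) (c : C), e.symm (s • c) = s • e.symm c := fun s c => e.injective (by
    rw [he, e.apply_symm_apply, e.apply_symm_apply])
  exact ⟨
    { toFun := fun r => ⟨fun g => e (r.1 g), fun s g => by rw [← he, ← r.2]⟩
      invFun := fun r => ⟨fun g => e.symm (r.1 g), fun s g => by rw [← he', ← r.2]⟩
      left_inv := fun r => Subtype.ext (funext fun g => e.symm_apply_apply _)
      right_inv := fun r => Subtype.ext (funext fun g => e.apply_symm_apply _)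
      map_mul' := fun r r' => Subtype.ext (funext fun g => map_mul e _ _)
      map_add' := fun r r' => Subtype.ext (funext fun g => map_add e _ _)
      commutes' := fun c => Subtype.ext (funext fun g => e.commutes c) }, fun g r => rfl⟩

variable {K B : Type*} [Finite G] [Field K] [Algebra k K] [Ring B] [Algebra k B] [Algebra K B]
  [IsScalarTower k K B]

/-- The conjugators form a `K`-basis, so `α u_x ↦ α • u x` is bijective; `hσ` makes it
multiplicative and `hγ` equivariant. -/
theorem GaloisDatum.isomorphic_alg (D : GaloisDatum k K G) [MulSemiringAction D.S B]
    [SMulCommClass D.S k B] (h : IsCentralGalois (B := B) D.toGal) (u : D.N → B)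
    (hu0 : ∀ x, u x ≠ 0) (hu : ∀ x, IsConjugator (Subgroup.inclusion D.N_le x) (u x))
    (hu1 : u 1 = 1) (hσ : ∀ x y, u x * u y = (D.σ x y : K) • u (x * y))
    (hγ : ∀ g x, g • u x = (D.γ g x : K) • u (D.conjS g x)) :
    GAlgIsomorphic k D.S D.Alg B := by
  cases nonempty_fintype D.N
  let F : D.Alg →+ B := Finsupp.liftAddHom (M := K) fun x =>
    { toFun := fun α => α • u x
      map_zero' := zero_smul K (u x)
      map_add' := fun α β => add_smul α β (u x) }
  have hF : ∀ x α, F (D.single x α) = α • u x := fun x α =>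
    Finsupp.liftAddHom_apply_single (M := K) _ x α
  have hFone : F 1 = 1 := (hF 1 1).trans (by rw [one_smul, hu1])
  have hFmul : ∀ a b, F (a * b) = F a * F b := fun a b => by
    induction a using GaloisDatum.Alg.induction with
    | zero => simp
    | add a a' ha ha' => simp only [map_add, add_mul, ha, ha']
    | single x α =>
      induction b using GaloisDatum.Alg.induction with
      | zero => simp
      | add b b' hb hb' => simp only [map_add, mul_add, hb, hb']
      | single y β =>
        rw [D.single_mul_single, hF, hF, hF, smul_mul_smul_comm, hσ, smul_smul]
  have hFsmul : ∀ (r : k) a, F (r • a) = r • F a := fun r a => by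
    induction a using GaloisDatum.Alg.induction with
    | zero => simp
    | add a a' ha ha' => simp only [map_add, smul_add, ha, ha']
    | single x α => rw [D.smul_single, hF, hF, smul_assoc]
  have hFact : ∀ (g : D.S) a, F (g • a) = g • F a := fun g a => by
    change F (D.act g a) = g • F a
    induction a using GaloisDatum.Alg.induction with
    | zero => simp
    | add a a' ha ha' => simp only [map_add, smul_add, ha, ha']
    | single x α => rw [D.act_single, hF, hF, h.smul_smul_eq, hγ, smul_smul]
  have hFsum : ∀ a : D.Alg, F a = ∑ x, (show D.N →₀ K from a) x • u x := fun a =>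
    Finsupp.sum_fintype (M := K) a (fun x α => α • u x) fun x => zero_smul K (u x)
  have hinj : Function.Injective (Subgroup.inclusion D.N_le) := Subgroup.inclusion_injective D.N_le
  have hrange : ∀ s, D.toGal s = 1 → s ∈ Set.range (Subgroup.inclusion D.N_le) := fun s hs => by
    have hs' : s ∈ D.N.subgroupOf D.S := D.toGal_ker ▸ hs
    exact ⟨⟨s.1, hs'⟩, rfl⟩
  let e : D.Alg →ₐ[k] B := AlgHom.ofLinearMap { F with map_smul' := hFsmul } hFone hFmul
  have hbij : Function.Bijective e := by
    refine ⟨(injective_iff_map_eq_zero e).mpr fun a ha => ?_, fun b => ?_⟩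
    · have ha' : ∑ x, (show D.N →₀ K from a) x • u x = 0 := (hFsum a).symm.trans ha
      exact Finsupp.ext (M := K) (congrFun (h.eq_zero_of_sum_smul hinj hu0 hu ha'))
    · obtain ⟨α, rfl⟩ := h.exists_sum_smul hinj hrange hu0 hu b
      exact ⟨Finsupp.equivFunOnFinite.symm α, hFsum _⟩
  exact ⟨AlgEquiv.ofBijective e hbij, hFact⟩

theorem GaloisDatum.isomorphic_ind (D : GaloisDatum k K G) [MulSemiringAction D.S B]
    [SMulCommClass D.S k B] (h : IsCentralGalois (B := B) D.toGal) (u : D.N → B)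
    (hu0 : ∀ x, u x ≠ 0) (hu : ∀ x, IsConjugator (Subgroup.inclusion D.N_le x) (u x))
    (hu1 : u 1 = 1) (hσ : ∀ x y, u x * u y = (D.σ x y : K) • u (x * y))
    (hγ : ∀ g x, g • u x = (D.γ g x : K) • u (D.conjS g x)) :
    GAlgIsomorphic k G (inducedAlgebra k D.S B) D.Ind :=
  (D.isomorphic_alg h u hu0 hu hu1 hσ hγ).symm.induced

end Comparison

/-! ### The center of a simple algebra over a real closed field -/

theorem IsRealClosed.surjective_algebraMap_or_adjoinI (k Z : Type*) [Field k] [IsRealClosed k]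
    [Field Z] [Algebra k Z] [FiniteDimensional k Z] : Function.Surjective (algebraMap k Z) ∨
      ∃ θ : AdjoinI k →ₐ[k] Z, Function.Surjective θ := by
  rcases surjective_algebraMap_or_gaussian (k := k) Z with hs | ⟨j, hj, hz⟩
  · exact Or.inl hs
  · right
    have hsplit : ((Polynomial.X ^ 2 + 1 : Polynomial k).map (algebraMap k Z)).Splits := by
      have : (Polynomial.X ^ 2 + 1 : Polynomial k).map (algebraMap k Z) =
          (Polynomial.X - Polynomial.C j) * (Polynomial.X - Polynomial.C (-j)) := by
        have h1 : (Polynomial.C j : Polynomial Z) ^ 2 = -1 := by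
          rw [← Polynomial.C_pow, hj]; simp
        simp only [Polynomial.map_add, Polynomial.map_pow, Polynomial.map_X, Polynomial.map_one,
          Polynomial.C_neg]
        linear_combination h1
      rw [this]
      exact (Polynomial.Splits.X_sub_C _).mul (Polynomial.Splits.X_sub_C _)
    let θ := Polynomial.SplittingField.lift (Polynomial.X ^ 2 + 1 : Polynomial k) hsplit
    obtain ⟨i, hi⟩ := AdjoinI.exists_sq_eq_neg_one k
    -- The embedding need not send `i` to `j`; in the other case the sign of `y` is changed.
    have hθ : θ i = j ∨ θ i = -j := sq_eq_sq_iff_eq_or_eq_neg.mp (by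
      rw [← map_pow, hi, hj, map_neg, map_one])
    refine ⟨θ, fun z => ?_⟩
    obtain ⟨x, y, rfl⟩ := hz z
    rcases hθ with h | h
    · exact ⟨algebraMap k _ x + algebraMap k _ y * i, by
        rw [map_add, map_mul, h, θ.commutes, θ.commutes]⟩
    · exact ⟨algebraMap k _ x + algebraMap k _ (-y) * i, by
        rw [map_add, map_mul, h, θ.commutes, θ.commutes, map_neg, neg_mul_neg]⟩

theorem center_eq_or_eq_adjoinI (k B : Type*) [Field k] [IsRealClosed k] [Ring B] [Algebra k B]
    [FiniteDimensional k B] [IsSimpleRing B] :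
    (∀ b : B, (∀ z, z * b = b * z) → ∃ a : k, algebraMap k B a = b) ∨
    ∃ θ : AdjoinI k →ₐ[k] B, (∀ b : B, (∀ z, z * b = b * z) → ∃ α, θ α = b) ∧
      ∀ α z, θ α * z = z * θ α := by
  have hZ : IsField (Subalgebra.center k B) := IsSimpleRing.isField_center B
  let : Field (Subalgebra.center k B) := hZ.toField
  have hmem : ∀ b : B, (∀ z, z * b = b * z) → b ∈ Subalgebra.center k B := fun b hb =>
    Subalgebra.mem_center_iff.mpr hb
  rcases IsRealClosed.surjective_algebraMap_or_adjoinI k (Subalgebra.center k B) with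
    hs | ⟨θ, hθ⟩
  · left
    intro b hb
    obtain ⟨a, ha⟩ := hs ⟨b, hmem b hb⟩
    exact ⟨a, congrArg Subtype.val ha⟩
  · right
    refine ⟨(Subalgebra.val _).comp θ, fun b hb => ?_, fun α z =>
      (Subalgebra.mem_center_iff.mp (θ α).2 z).symm⟩
    obtain ⟨α, hα⟩ := hθ ⟨b, hmem b hb⟩
    exact ⟨α, congrArg Subtype.val hα⟩

/-! ### The real case -/

theorem Units.mem_zpowers_neg_one {K : Type*} [Field K] {α : Kˣ} (h : (α : K) ^ 2 = 1) :
    α ∈ Subgroup.zpowers (-1 : Kˣ) := by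
  rcases sq_eq_sq_iff_eq_or_eq_neg.mp (h.trans (one_pow 2).symm) with h | h
  · rw [show α = 1 from Units.ext h]
    exact one_mem _
  · rw [show α = -1 from Units.ext h]
    exact Subgroup.mem_zpowers _

/-- Rescaling by an element of a real closed field makes a nonzero scalar a sign. -/
theorem IsRealClosed.exists_mul_sq_eq {k : Type*} [Field k] [IsRealClosed k] {a : k}
    (ha : a ≠ 0) : ∃ c : k, c ≠ 0 ∧ (c * c * a = 1 ∨ c * c * a = -1) := by
  rcases isSquare_or_isSquare_neg a with ⟨b, hb⟩ | ⟨b, hb⟩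
  · have hb0 : b ≠ 0 := by
      rintro rfl
      exact ha (by simpa using hb)
    exact ⟨b⁻¹, inv_ne_zero hb0, Or.inl (by rw [hb]; field_simp)⟩
  · have hb0 : b ≠ 0 := by
      rintro rfl
      exact ha (by simpa using hb)
    refine ⟨b⁻¹, inv_ne_zero hb0, Or.inr ?_⟩
    rw [← neg_neg a, hb]
    field_simp

section Real

variable {k G B : Type*} [Field k] [IsRealClosed k] [Group G] [Finite G] {S : Subgroup G} [Ring B]
  [Algebra k B] [MulSemiringAction S B] [SMulCommClass S k B]

theorem exists_realTorsorDatum {f : S →* (k ≃ₐ[k] k)} (h : IsCentralGalois (B := B) f)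
    (hS : S.Normal) (hcard : Nat.card S ≤ Nat.card (equivariantAut k S B))
    (hψ : ∀ g : G, ∃ ψ : B ≃ₐ[k] B, ∀ s t : S, t.1 = g * s.1 * g⁻¹ → ∀ b, ψ (s • b) = t • ψ b) :
    ∃ D : RealTorsorDatum k G, GAlgIsomorphic k G (inducedAlgebra k S B) D.toGaloisDatum.Ind := by
  have := h.isGaloisAlgebra.nontrivial
  have hf : ∀ s, f s = 1 := fun s => Subsingleton.elim _ _
  obtain ⟨-, hsep⟩ := h.of_card_le_card_equivariantAut hcard
  have hcomm : ∀ x y : S, x * y = y * x := fun x y => congrArg Subtype.val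
    (hsep (⟨x, hf x⟩ * ⟨y, hf y⟩) (⟨y, hf y⟩ * ⟨x, hf x⟩) fun χ _ => by
      rw [map_mul, map_mul, mul_comm])
  -- The values of the characters are roots of unity in `k`, hence signs, and the characters
  -- separate points.
  have hsq : ∀ x : S, x ^ 2 = 1 := fun x => congrArg Subtype.val
    (hsep (⟨x, hf x⟩ ^ 2) 1 fun χ _ => by
      rw [map_pow, map_one]
      refine sq_eq_one_of_pow_eq_one (n := Nat.card f.ker) Nat.card_pos.ne' ?_
      rw [← map_pow, pow_card_eq_one', map_one])
  have hmul : ∀ x : S, x * x = 1 := fun x => by rw [← sq, hsq]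
  -- As `x` has square `1`, the square of a conjugator is a scalar, which rescaling by a real square
  -- root makes a sign. Taking `u = 1` at `x = 1` normalizes the cocycle.
  have hex : ∀ x : S, ∃ u : B, u ≠ 0 ∧ IsConjugator x u ∧ (u * u = 1 ∨ u * u = -1) ∧
      (x = 1 → u = 1) := fun x => by
    by_cases hx : x = 1
    · exact ⟨1, one_ne_zero, hx ▸ IsConjugator.one, Or.inl (mul_one 1), fun _ => rfl⟩
    · obtain ⟨u, hu0, hu⟩ := h.exists_conjugator ⟨x, hf x⟩
      obtain ⟨α, hα⟩ := h.exists_unit_smul_eq IsConjugator.one one_ne_zero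
        (hmul x ▸ hu.mul hu) (h.mul_ne_zero hu hu0 hu hu0)
      obtain ⟨c, hc0, hc⟩ := IsRealClosed.exists_mul_sq_eq α.ne_zero
      refine ⟨c • u, smul_ne_zero hc0 hu0, hu.smul c, ?_, fun h1 => absurd h1 hx⟩
      rw [smul_mul_smul_comm, hα, smul_smul]
      rcases hc with hc | hc <;> rw [hc]
      · exact Or.inl (one_smul k 1)
      · exact Or.inr (by rw [neg_smul, one_smul])
  choose u hu0 hu husq hu1 using hex
  have hu1 : u 1 = 1 := hu1 1 rfl
  obtain ⟨σ, hσ⟩ := h.exists_twoCocycle (j := MonoidHom.id S) hu0 hu hu1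
  have halt : ∀ x y, (σ.alt x y : k) ^ 2 = 1 := fun x y => by
    have h1 : x • x • u y = u y := by rw [smul_smul, hmul, one_smul]
    have h2 : x • u y = (σ.alt x y : k) • u y :=
      h.smul_eq_alt (j := MonoidHom.id S) hu0 hu hσ (hcomm x y)
    rw [h2, smul_comm, h2, smul_smul] at h1
    exact smul_left_injective k (hu0 y) (by
      change (σ.alt x y : k) ^ 2 • u y = (1 : k) • u y
      rw [sq, h1, one_smul])
  have hσ2 : ∀ x y, (σ x y : k) ^ 2 = 1 := fun x y =>
    (σ.sq_eq_one_or_neg_one hσ husq hcomm halt x y).resolve_right (sq_ne_neg_one _)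
  let D : RealTorsorDatum k G :=
    { N := S
      N_normal := hS
      elementary :=
        { comm := fun x hx y hy => congrArg Subtype.val (hcomm ⟨x, hx⟩ ⟨y, hy⟩)
          sq_eq_one := fun x hx => congrArg Subtype.val (hsq ⟨x, hx⟩) }
      σ := σ
      σ_mem_two := fun x y => Units.mem_zpowers_neg_one (hσ2 x y)
      nondegenerate := h.isNondegenerate (j := MonoidHom.id S) Function.injective_id
        (fun s _ => ⟨s, rfl⟩) hf hu0 hu hσ hcomm
      cohomologous := fun g => by
        obtain ⟨ψ, hψ⟩ := hψ g
        let c : S →* S :=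
          { toFun := conjIn S g (fun n hn => hS.conj_mem n hn g)
            map_one' := Subtype.ext (by simp [conjIn])
            map_mul' := fun x y => Subtype.ext (by simp [conjIn]) }
        obtain ⟨η, hη, hη1, hησ⟩ := h.exists_coboundary (j := MonoidHom.id S) hu0 hu hu1 hσ ψ
          (fun α => ψ.commutes α) c (fun x b => hψ x (c x) rfl b)
        -- `u (c x)` and `ψ (u x)` both have square `±1`, so `η x ^ 2 = ±1`; the value `-1` is not a
        -- square in `k`.
        refine ⟨η, fun x => Units.mem_zpowers_neg_one ?_, hη1, hησ⟩
        refine (sq_eq_one_or_neg_one_of_smul (husq (c x)) ?_ (hη x)).resolve_right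
          (sq_ne_neg_one _)
        rw [← map_mul]
        rcases husq x with hx | hx <;> rw [hx]
        · exact Or.inl (map_one ψ)
        · exact Or.inr (by rw [map_neg, map_one]) }
  refine ⟨D, ?_⟩
  have hDγ : ∀ (g x : S), g • u x = (σ.inner g x : k) •
      u (conjIn S g (fun y hy => S.mul_mem (S.mul_mem g.2 hy) (S.inv_mem g.2)) x) := fun g x => by
    have h1 : conjIn S g (fun y hy => S.mul_mem (S.mul_mem g.2 hy) (S.inv_mem g.2)) x = x :=
      Subtype.ext (by
        change ((g * x * g⁻¹ : S) : G) = x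
        rw [hcomm g x, mul_inv_cancel_right])
    rw [h1, σ.inner_eq_alt hcomm]
    exact h.smul_eq_alt (j := MonoidHom.id S) hu0 hu hσ (hcomm g x)
  let : MulSemiringAction D.toGaloisDatum.S B := ‹MulSemiringAction S B›
  have : SMulCommClass D.toGaloisDatum.S k B := ‹SMulCommClass S k B›
  have hD : IsCentralGalois (B := B) D.toGaloisDatum.toGal :=
    ⟨h.isGaloisAlgebra, h.isSimpleRing, h.center, fun s α => smul_algebraMap s α⟩
  exact D.toGaloisDatum.isomorphic_ind hD u hu0 hu hu1 hσ hDγ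

end Real

/-! ### The semi-real case: structure of the group -/

namespace IsCentralGalois

section General

variable {k K S B : Type*} [Field k] [Field K] [Algebra k K] [Group S] [Finite S] [Ring B]
  [Algebra k B] [Algebra K B] [MulSemiringAction S B] [SMulCommClass S k B]
  {f : S →* (K ≃ₐ[k] K)}

/-- Conjugators of elements of the kernel span `B`, and `S` acts faithfully. -/
theorem eq_of_forall_smul_eq (h : IsCentralGalois (B := B) f) {s t : S}
    (hst : ∀ (y : S) (u : B), f y = 1 → IsConjugator y u → u ≠ 0 → s • u = t • u) : s = t := by
  cases nonempty_fintype S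
  rw [← inv_mul_eq_one]
  refine h.isGaloisAlgebra.eq_one_of_forall_smul_eq fun b => ?_
  obtain ⟨c, hc, rfl⟩ := h.isGaloisAlgebra.exists_sum_conjugators b
  rw [Finset.smul_sum]
  refine Finset.sum_congr rfl fun y _ => ?_
  by_cases h0 : c y = 0
  · rw [h0, smul_zero]
  · rw [mul_smul, inv_smul_eq_iff]
    exact (hst y (c y) (h.map_eq_one (hc y) h0) (hc y) h0).symm

/-- For `x` and `y` commuting, with `x` acting trivially on the center, `x` multiplies the
conjugators of `y` by a root of unity. -/
theorem exists_root_smul_eq (h : IsCentralGalois (B := B) f) {x y : S} (hx : f x = 1)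
    (hxy : x * y = y * x) {u : B} (hu : IsConjugator y u) (hu0 : u ≠ 0) :
    ∃ β : K, x • u = β • u ∧ ∀ n : ℕ, x ^ n = 1 → β ^ n = 1 := by
  have hxy' : x * y * x⁻¹ = y := by rw [hxy, mul_inv_cancel_right]
  obtain ⟨β, hβ⟩ := h.exists_smul_eq hu hu0 (hxy' ▸ hu.act x)
  have hpow : ∀ n : ℕ, x ^ n • u = β ^ n • u := fun n => by
    induction n with
    | zero => simp
    | succ n ih =>
      rw [pow_succ', mul_smul, ih, h.smul_apply_of_map_eq_one hx, hβ, smul_smul, pow_succ]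
  refine ⟨β, hβ, fun n hn => smul_left_injective K hu0 ?_⟩
  change β ^ n • u = (1 : K) • u
  rw [← hpow, hn, one_smul, one_smul]

end General

section AdjoinI

variable {k S B : Type*} [Field k] [IsRealClosed k] [Group S] [Finite S] [Ring B] [Algebra k B]
  [Algebra (AdjoinI k) B] [MulSemiringAction S B]
  [SMulCommClass S k B] {f : S →* (AdjoinI k ≃ₐ[k] AdjoinI k)}

/-- An element acting by complex conjugation on the center has order two. -/
theorem mul_self_eq_one (h : IsCentralGalois (B := B) f) (hcomm : ∀ s t : S, s * t = t * s)
    (hsq : ∀ x : S, f x = 1 → x * x = 1) {g : S} (hg : f g ≠ 1) : g * g = 1 := by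
  have hgg : f (g * g) = 1 := by
    by_contra h1
    rw [map_mul] at h1
    exact hg (mul_eq_left.mp (AdjoinI.eq_of_ne_one h1 hg))
  refine h.eq_of_forall_smul_eq fun y u hy hu hu0 => ?_
  obtain ⟨β, hβ, hβn⟩ := h.exists_root_smul_eq hgg (hcomm _ y) hu hu0
  have hgy : g * y * g⁻¹ = y := by rw [hcomm g y, mul_inv_cancel_right]
  obtain ⟨χ, hχ⟩ := h.exists_smul_eq hu hu0 (hgy ▸ hu.act g)
  -- Applying the semilinear `g` twice makes `β` a norm; its square is `1`, so positivity gives `β =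
  -- 1`.
  have hβχ : β = f g χ * χ := smul_left_injective (AdjoinI k) hu0 (by
    change β • u = (f g χ * χ) • u
    rw [← hβ, mul_smul, hχ, h.smul_smul_eq, hχ, smul_smul])
  have hβ2 : β ^ 2 = 1 := hβn 2 (by rw [sq, hsq _ hgg])
  rw [hβ, hβχ, AdjoinI.mul_apply_eq_one_of_pow_eq_one hg two_ne_zero (hβχ ▸ hβ2), one_smul,
    one_smul]

/-- Conjugators can be normalized to be invariant under a given complex conjugation and to have
square `±1`. -/
theorem exists_normalized_conjugator (h : IsCentralGalois (B := B) f)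
    (hcomm : ∀ s t : S, s * t = t * s) {g : S} (hg : f g ≠ 1) (hgg : g * g = 1) {y : S}
    (hyy : y * y = 1) {u : B} (hu : IsConjugator y u) (hu0 : u ≠ 0) :
    ∃ v : B, v ≠ 0 ∧ IsConjugator y v ∧ g • v = v ∧ (v * v = 1 ∨ v * v = -1) := by
  have := h.isGaloisAlgebra.nontrivial
  have hgy : g * y * g⁻¹ = y := by rw [hcomm g y, mul_inv_cancel_right]
  obtain ⟨χ, hχ⟩ := h.exists_smul_eq hu hu0 (hgy ▸ hu.act g)
  -- Since `g * g = 1`, the scalar `χ` has norm one, so Hilbert 90 rescales `u` to an invariant `w`.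
  -- Then `w * w` is an invariant scalar, hence in `k`, and a scaling by `k` makes it a sign without
  -- losing invariance.
  have hχ1 : f g χ * χ = 1 := smul_left_injective (AdjoinI k) hu0 (by
    change (f g χ * χ) • u = (1 : AdjoinI k) • u
    rw [mul_smul, ← hχ, ← h.smul_smul_eq, ← hχ, smul_smul, hgg, one_smul, one_smul])
  obtain ⟨c, hc0, hc⟩ := AdjoinI.exists_apply_mul_eq hg hχ1
  have hw0 : c • u ≠ 0 := smul_ne_zero hc0 hu0
  have hw : IsConjugator y (c • u) := hu.smul c
  have hgw : g • (c • u) = c • u := by rw [h.smul_smul_eq, hχ, smul_smul, hc]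
  set w := c • u
  obtain ⟨α, hα⟩ := h.exists_unit_smul_eq IsConjugator.one one_ne_zero
    (hyy ▸ hw.mul hw) (h.mul_ne_zero hw hw0 hw hw0)
  have hgα : g • ((α : AdjoinI k) • (1 : B)) = (α : AdjoinI k) • (1 : B) := by
    rw [← hα, smul_mul', hgw]
  rw [h.smul_smul_eq, smul_one] at hgα
  have hfα : f g α = α := smul_left_injective (AdjoinI k) (one_ne_zero' B) hgα
  obtain ⟨a, ha⟩ := AdjoinI.exists_eq_algebraMap_of_apply_eq hg hfα
  have ha0 : a ≠ 0 := by
    rintro rfl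
    exact α.ne_zero (by rw [ha, map_zero])
  obtain ⟨d, hd0, hd⟩ := IsRealClosed.exists_mul_sq_eq ha0
  refine ⟨algebraMap k (AdjoinI k) d • w, smul_ne_zero ((map_ne_zero _).mpr hd0) hw0, hw.smul _,
    ?_, ?_⟩
  · rw [h.smul_smul_eq, hgw, AlgEquiv.commutes]
  · rw [smul_mul_smul_comm, hα, smul_smul, ha, ← map_mul, ← map_mul]
    rcases hd with hd | hd <;> rw [hd]
    · exact Or.inl (by rw [map_one, one_smul])
    · exact Or.inr (by rw [map_neg, map_one, neg_smul, one_smul])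

variable [IsScalarTower k (AdjoinI k) B]

theorem elementary_of_card_le (h : IsCentralGalois (B := B) f)
    (hcard : Nat.card S ≤ Nat.card (equivariantAut k S B)) :
    (∀ s t : S, s * t = t * s) ∧ ∀ x : S, f x = 1 → x * x = 1 := by
  have := h.isGaloisAlgebra.nontrivial
  obtain ⟨hsurj, hsep⟩ := h.of_card_le_card_equivariantAut hcard
  obtain ⟨ω, hω⟩ := AdjoinI.exists_aut_ne_one k
  obtain ⟨g, hg⟩ := h.surjective ω
  obtain ⟨φ, hφ, hφω⟩ := hsurj ω
  have hN : ∀ x y : S, f x = 1 → f y = 1 → x * y = y * x := fun x y hx hy =>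
    congrArg Subtype.val (hsep (⟨x, hx⟩ * ⟨y, hy⟩) (⟨y, hy⟩ * ⟨x, hx⟩) fun χ _ => by
      rw [map_mul, map_mul, mul_comm])
  have hconj : ∀ x : S, f x = 1 → f (g * x * g⁻¹) = 1 := fun x hx => by
    rw [map_mul, map_mul, hx, mul_one, map_inv, mul_inv_cancel]
  -- For an equivariant character, `χ (g x g⁻¹) χ x` is the norm of a root of unity, hence `1`.
  have hinv : ∀ x : S, f x = 1 → g * x * g⁻¹ * x = 1 := fun x hx =>
    congrArg Subtype.val (hsep (⟨g * x * g⁻¹, hconj x hx⟩ * ⟨x, hx⟩) 1 fun χ hχ => by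
      rw [map_mul, map_one, hχ g ⟨x, hx⟩ ⟨g * x * g⁻¹, hconj x hx⟩ rfl, hg]
      refine AdjoinI.mul_apply_eq_one_of_pow_eq_one hω (n := Nat.card f.ker) Nat.card_pos.ne' ?_
      rw [mul_pow, ← map_pow, ← map_pow, pow_card_eq_one', map_one, map_one, mul_one])
  have hsq : ∀ x : S, f x = 1 → x * x = 1 := fun x hx => by
    refine h.eq_of_forall_smul_eq fun y u hy hu hu0 => ?_
    obtain ⟨β, hβ, hβn⟩ := h.exists_root_smul_eq hx (hN x y hx hy) hu hu0
    obtain ⟨χ, hχ⟩ := h.exists_unit_smul_eq hu hu0 (hu.map φ fun b => hφ y b) (by simpa using hu0)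
    -- The lift `φ` of complex conjugation commutes with `x` and scales `u`, so applying it to `x •
    -- u = β • u` conjugates `β` without changing the eigenvalue. Thus `β` is a real root of unity,
    -- a sign, and `x * x` fixes `u`.
    have hωβ : ω β = β := by
      have h1 : φ (x • u) = x • φ u := hφ x u
      rw [hβ, Algebra.smul_def, map_mul, hφω, ← Algebra.smul_def, hχ,
        h.smul_apply_of_map_eq_one hx, hβ, smul_smul, smul_smul] at h1
      have h2 := smul_left_injective (AdjoinI k) hu0 h1
      exact mul_right_cancel₀ χ.ne_zero (h2.trans (mul_comm _ _))
    obtain ⟨a, rfl⟩ := AdjoinI.exists_eq_algebraMap_of_apply_eq hω hωβ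
    have ha : a ^ 2 = 1 := by
      refine sq_eq_one_of_pow_eq_one (n := Nat.card S) Nat.card_pos.ne' ?_
      exact (algebraMap k (AdjoinI k)).injective (by rw [map_pow, hβn _ (pow_card_eq_one' (G := S)), map_one])
    rw [mul_smul, hβ, h.smul_apply_of_map_eq_one hx, hβ, smul_smul, ← map_mul, ← sq, ha, map_one,
      one_smul, one_smul]
  have hgN : ∀ x : S, f x = 1 → g * x = x * g := fun x hx => by
    have h1 := hinv x hx
    have h2 : g * x * g⁻¹ = x := by
      rw [← mul_left_inj x, h1, hsq x hx]
    exact mul_inv_eq_iff_eq_mul.mp h2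
  have hdecomp : ∀ s : S, f s = 1 ∨ ∃ n, f n = 1 ∧ s = g * n := fun s => by
    by_cases hs : f s = 1
    · exact Or.inl hs
    · refine Or.inr ⟨g⁻¹ * s, ?_, by rw [mul_inv_cancel_left]⟩
      rw [map_mul, map_inv, hg, AdjoinI.eq_of_ne_one hs hω, inv_mul_cancel]
  refine ⟨fun s t => ?_, hsq⟩
  rcases hdecomp s with hs | ⟨n, hn, rfl⟩ <;> rcases hdecomp t with ht | ⟨m, hm, rfl⟩
  · exact hN s t hs ht
  · rw [← mul_assoc, ← hgN s hs, mul_assoc, hN s m hs hm, mul_assoc]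
  · rw [mul_assoc, hN n t hn ht, ← mul_assoc, hgN t ht, mul_assoc]
  · rw [mul_assoc, ← mul_assoc n, ← hgN n hn, mul_assoc g m, ← mul_assoc m, ← hgN m hm,
      mul_assoc g n, mul_assoc g m, hN n m hn hm]

end AdjoinI

end IsCentralGalois

/-! ### The semi-real case: construction of the datum -/

theorem AlgEquiv.apply_eq_of_sq_eq_one {k K : Type*} [Field k] [Field K] [Algebra k K]
    (ω : K ≃ₐ[k] K) {z : K} (hz : z ^ 2 = 1) : ω z = z := by
  rcases sq_eq_sq_iff_eq_or_eq_neg.mp (hz.trans (one_pow 2).symm) with rfl | rfl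
  · exact map_one ω
  · rw [map_neg, map_one]

theorem Units.mem_range_map_algebraMap_of_sq_eq_one (k : Type*) {K : Type*} [Field k] [Field K]
    [Algebra k K] {α : Kˣ} (h : (α : K) ^ 2 = 1) :
    α ∈ (Units.map (algebraMap k K : k →* K)).range := by
  rcases sq_eq_sq_iff_eq_or_eq_neg.mp (h.trans (one_pow 2).symm) with h | h
  · exact ⟨1, Units.ext (by rw [h]; simp)⟩
  · exact ⟨-1, Units.ext (by rw [h]; simp)⟩

theorem Units.mem_rootsOfUnity_four {K : Type*} [Field K] {α : Kˣ}
    (h : (α : K) ^ 2 = 1 ∨ (α : K) ^ 2 = -1) : α ∈ rootsOfUnity 4 K := by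
  rw [mem_rootsOfUnity']
  rcases h with h | h
  · linear_combination ((α : K) ^ 2 + 1) * h
  · linear_combination ((α : K) ^ 2 - 1) * h

theorem exists_isPrimitiveRoot_exponent {k N : Type*} [Field k] [CharZero k] [Group N]
    (hN : ∀ x : N, x ^ 2 = 1) : ∃ ζ : k, IsPrimitiveRoot ζ (Monoid.exponent N) := by
  rcases (Nat.dvd_prime Nat.prime_two).mp (Monoid.exponent_dvd_of_forall_pow_eq_one hN) with h | h
  · exact ⟨1, h ▸ IsPrimitiveRoot.one⟩
  · exact ⟨-1, h ▸ IsPrimitiveRoot.neg_one 0 two_ne_zero.symm⟩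

/-- The automorphisms relating conjugate actions of `S` can be chosen trivial on the center. -/
theorem IsCentralGalois.exists_central_conj {k K G B : Type*} [Field k] [Field K]
    [Algebra k K] [Group G] [Finite G] {S : Subgroup G} [Ring B] [Algebra k B] [Algebra K B]
    [IsScalarTower k K B] [MulSemiringAction S B] [SMulCommClass S k B] {f : S →* (K ≃ₐ[k] K)}
    (h : IsCentralGalois (B := B) f)
    (hcomm : ∀ s t : S, s * t = t * s) (g : G)
    (hψ : ∃ ψ : B ≃ₐ[k] B, ∀ s t : S, t.1 = g * s.1 * g⁻¹ → ∀ b, ψ (s • b) = t • ψ b) :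
    ∃ ψ : B ≃ₐ[k] B, (∀ α, ψ (algebraMap K B α) = algebraMap K B α) ∧
      ∀ s t : S, t.1 = g * s.1 * g⁻¹ → ∀ b, ψ (s • b) = t • ψ b := by
  have := h.isGaloisAlgebra.nontrivial
  obtain ⟨ψ, hψ⟩ := hψ
  obtain ⟨ρ, hρ⟩ := exists_gal_of_center (k := k) (Γ := B ≃ₐ[k] B) h.center
  obtain ⟨r, hr⟩ := h.surjective (ρ ψ)⁻¹
  -- Composing with `r`, which undoes the action of `ψ` on the center, keeps the intertwining
  -- property because `S` is commutative.
  refine ⟨ψ.trans (MulSemiringAction.toAlgEquiv k B r), fun α => ?_, fun s t hst b => ?_⟩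
  · have h1 : ψ (algebraMap K B α) = algebraMap K B (ρ ψ α) := hρ ψ α
    change r • ψ (algebraMap K B α) = _
    rw [h1, h.smul_algebraMap, hr, ← AlgEquiv.mul_apply, inv_mul_cancel, AlgEquiv.one_apply]
  · change r • ψ (s • b) = t • r • ψ b
    rw [hψ s t hst, smul_smul, smul_smul, hcomm]

section SemiReal

variable {k G B : Type*} [Field k] [IsRealClosed k] [Group G] [Finite G] {S : Subgroup G} [Ring B]
  [Algebra k B] [Algebra (AdjoinI k) B] [IsScalarTower k (AdjoinI k) B] [MulSemiringAction S B]
  [SMulCommClass S k B] {f : S →* (AdjoinI k ≃ₐ[k] AdjoinI k)}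

set_option maxHeartbeats 1000000 in
theorem exists_semiRealTorsorDatum (h : IsCentralGalois (B := B) f) (hS : S.Normal)
    (hcard : Nat.card S ≤ Nat.card (equivariantAut k S B))
    (hψ : ∀ g : G, ∃ ψ : B ≃ₐ[k] B, ∀ s t : S, t.1 = g * s.1 * g⁻¹ → ∀ b, ψ (s • b) = t • ψ b) :
    ∃ D : SemiRealTorsorDatum k G,
      GAlgIsomorphic k G (inducedAlgebra k S B) D.toGaloisDatum.Ind ∧
        IsElementaryAbelianTwo D.N := by
  classical
  have := h.isGaloisAlgebra.nontrivial
  obtain ⟨hcomm, hsq⟩ := h.elementary_of_card_le hcard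
  obtain ⟨ω, hω⟩ := AdjoinI.exists_aut_ne_one k
  obtain ⟨g₀, hg₀⟩ := h.surjective ω
  have hfg₀ : f g₀ ≠ 1 := hg₀ ▸ hω
  have hg₀g₀ : g₀ * g₀ = 1 := h.mul_self_eq_one hcomm hsq hfg₀
  let N : Subgroup G := f.ker.map S.subtype
  have hNS : N ≤ S := Subgroup.map_subtype_le f.ker
  let j : N →* S := Subgroup.inclusion hNS
  have hj : Function.Injective j := Subgroup.inclusion_injective hNS
  have hjf : ∀ x, f (j x) = 1 := fun x => by
    obtain ⟨s, hs, hsx⟩ := x.2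
    rw [show j x = s from Subtype.ext hsx.symm]
    exact hs
  have hr : ∀ s, f s = 1 → s ∈ Set.range j := fun s hs => ⟨⟨s.1, ⟨s, hs, rfl⟩⟩, rfl⟩
  have hNcomm : ∀ x y : N, x * y = y * x := fun x y => hj (by rw [map_mul, map_mul, hcomm])
  have hNsq : ∀ x : N, x * x = 1 := fun x => hj (by rw [map_mul, map_one, hsq _ (hjf x)])
  have hex : ∀ x : N, ∃ u : B, u ≠ 0 ∧ IsConjugator (j x) u ∧ g₀ • u = u ∧
      (u * u = 1 ∨ u * u = -1) ∧ (x = 1 → u = 1) := fun x => by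
    by_cases hx : x = 1
    · refine ⟨1, one_ne_zero, ?_, smul_one g₀, Or.inl (mul_one 1), fun _ => rfl⟩
      rw [hx, map_one]
      exact IsConjugator.one
    · obtain ⟨u, hu0, hu⟩ := h.exists_conjugator ⟨j x, hjf x⟩
      obtain ⟨v, hv0, hv, hgv, hvv⟩ := h.exists_normalized_conjugator hcomm hfg₀ hg₀g₀
        (hsq _ (hjf x)) hu hu0
      exact ⟨v, hv0, hv, hgv, hvv, fun h1 => absurd h1 hx⟩
  choose u hu0 hu hgu husq hu1 using hex
  replace hu1 : u 1 = 1 := hu1 1 rfl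
  have hcancel : ∀ {x : N} {α β : AdjoinI k}, α • u x = β • u x → α = β := fun he =>
    smul_left_injective (AdjoinI k) (hu0 _) he
  obtain ⟨σ, hσ⟩ := h.exists_twoCocycle hu0 hu hu1
  have hact : ∀ (s : S) (x : N), ∃ γ : (AdjoinI k)ˣ, s • u x = (γ : AdjoinI k) • u x :=
    fun s x => by
      have h1 : s * j x * s⁻¹ = j x := by rw [hcomm s, mul_inv_cancel_right]
      exact h.exists_unit_smul_eq (hu x) (hu0 x) (h1 ▸ (hu x).act s)
        fun h0 => hu0 x ((smul_eq_zero_iff_eq s).mp h0)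
  choose γ hγ using hact
  have hγker : ∀ (s : S) (x : N), f s = 1 → (γ s x : AdjoinI k) ^ 2 = 1 := fun s x hs => by
    obtain ⟨β, hβ, hβn⟩ := h.exists_root_smul_eq hs (hcomm s _) (hu x) (hu0 x)
    rw [hcancel ((hγ s x).symm.trans hβ)]
    exact hβn 2 (by rw [sq, hsq s hs])
  -- Outside the kernel, write `s = g₀ n`; as `g₀` fixes `u x`, `γ s x` is the conjugate of the sign
  -- `γ n x`.
  have hγ2 : ∀ (s : S) (x : N), (γ s x : AdjoinI k) ^ 2 = 1 := fun s x => by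
    by_cases hs : f s = 1
    · exact hγker s x hs
    · have hn : f (g₀⁻¹ * s) = 1 := by
        rw [map_mul, map_inv, AdjoinI.eq_of_ne_one hs hfg₀, inv_mul_cancel]
      have h1 : (γ s x : AdjoinI k) = f g₀ (γ (g₀⁻¹ * s) x) := hcancel (by
        rw [← hγ, ← mul_inv_cancel_left g₀ s, mul_smul, hγ, h.smul_smul_eq, hgu,
          mul_inv_cancel_left])
      rw [h1, ← map_pow, hγker _ x hn, map_one]
  have hγfix : ∀ (s t : S) (x : N), f s (γ t x) = γ t x := fun s t x =>
    AlgEquiv.apply_eq_of_sq_eq_one _ (hγ2 t x)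
  have hγalt : ∀ x y : N, γ (j x) y = σ.alt x y := fun x y => Units.ext (hcancel (by
    rw [← hγ]
    exact h.smul_eq_alt hu0 hu hσ (hNcomm x y)))
  -- Invariance of the `u x` under `g₀` makes `σ` real, and this excludes `σ ^ 2 = -1`, which is
  -- possible in `k(i)`.
  have hσ2 : ∀ x y, (σ x y : AdjoinI k) ^ 2 = 1 := fun x y => by
    have hfix : f g₀ (σ x y) = σ x y := hcancel (x := x * y) (by
      have h1 : g₀ • (u x * u y) = u x * u y := by rw [smul_mul', hgu, hgu]
      rwa [hσ, h.smul_smul_eq, hgu] at h1)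
    obtain ⟨a, ha⟩ := AdjoinI.exists_eq_algebraMap_of_apply_eq hfg₀ hfix
    refine (σ.sq_eq_one_or_neg_one hσ husq hNcomm (fun x y => hγalt x y ▸ hγ2 _ _)
      x y).resolve_right fun h1 => sq_ne_neg_one a ((algebraMap k (AdjoinI k)).injective ?_)
    rw [map_pow, ← ha, h1, map_neg, map_one]
  have hσfix : ∀ (s : S) (x y : N), f s (σ x y) = σ x y := fun s x y =>
    AlgEquiv.apply_eq_of_sq_eq_one _ (hσ2 x y)
  have hγl : ∀ s t x, γ (s * t) x = γ s x * γ t x := fun s t x => Units.ext (hcancel (by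
    rw [← hγ, mul_smul, hγ, h.smul_smul_eq, hγ, hγfix, smul_smul, Units.val_mul, mul_comm]))
  have hγr : ∀ s x y, γ s (x * y) = γ s x * γ s y := fun s x y => Units.ext (by
    have h1 : s • (u x * u y) = ((γ s x : AdjoinI k) * γ s y) • (u x * u y) := by
      rw [smul_mul', hγ, hγ, smul_mul_smul_comm]
    rw [hσ, h.smul_smul_eq, hγ, hσfix, smul_smul, smul_smul, mul_comm] at h1
    exact mul_right_cancel₀ (σ x y).ne_zero (hcancel h1))
  have hconjS : ∀ (s : G) (hs : s ∈ S) (x : N) (hx : ∀ y ∈ N, s * y * s⁻¹ ∈ N),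
      conjIn N s hx x = x := fun s hs x hx => Subtype.ext (by
    have h1 := congrArg Subtype.val (hcomm ⟨s, hs⟩ (j x))
    change s * x.1 * s⁻¹ = x.1
    rw [show s * x.1 = x.1 * s from h1, mul_inv_cancel_right])
  -- An intertwiner trivial on the center shows that conjugate elements of `S` act alike on `k(i)`;
  -- so `N` is normal in `G`.
  have hconjf : ∀ (g : G) (s t : S), t.1 = g * s.1 * g⁻¹ → f t = f s := fun g s t hst => by
    obtain ⟨ψ, hψc, hψ⟩ := h.exists_central_conj hcomm g (hψ g)
    refine AlgEquiv.ext fun α => (algebraMap (AdjoinI k) B).injective ?_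
    have h1 := hψ s t hst (algebraMap (AdjoinI k) B α)
    rw [h.smul_algebraMap, hψc, hψc, h.smul_algebraMap] at h1
    exact h1.symm
  have hNnormal : N.Normal := ⟨fun x hx g =>
    ⟨⟨g * x * g⁻¹, hS.conj_mem x (hNS hx) g⟩,
      (hconjf g ⟨x, hNS hx⟩ _ rfl).trans (hjf ⟨x, hx⟩), rfl⟩⟩
  have hcoh : ∀ g : G, ∃ η : N → (AdjoinI k)ˣ, (∀ x, η x ∈ rootsOfUnity 4 (AdjoinI k)) ∧
      η 1 = 1 ∧
      (∀ x y, σ (conjIn N g (fun n hn => hNnormal.conj_mem n hn g) x)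
        (conjIn N g (fun n hn => hNnormal.conj_mem n hn g) y) =
          σ x y * (η y * η x / η (x * y))) ∧
      ∀ s x, (γ (conjIn S g (fun n hn => hS.conj_mem n hn g) s)
        (conjIn N g (fun n hn => hNnormal.conj_mem n hn g) x) : AdjoinI k) =
          γ s x * (f s (η x) / η x) := fun g => by
    obtain ⟨ψ, hψc, hψ⟩ := h.exists_central_conj hcomm g (hψ g)
    let c : N →* N :=
      { toFun := conjIn N g (fun n hn => hNnormal.conj_mem n hn g)
        map_one' := Subtype.ext (by simp [conjIn])
        map_mul' := fun x y => Subtype.ext (by simp [conjIn]) }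
    obtain ⟨η, hη, hη1, hησ⟩ := h.exists_coboundary hu0 hu hu1 hσ ψ hψc c
      (fun x b => hψ (j x) (j (c x)) rfl b)
    -- Here `η x ^ 2 = -1` is not ruled out, since `k(i)` contains `i`; hence `μ₄` instead of `μ₂`.
    refine ⟨η, fun x => Units.mem_rootsOfUnity_four ?_, hη1, hησ, fun s x => ?_⟩
    · refine sq_eq_one_or_neg_one_of_smul (husq (c x)) ?_ (hη x)
      rw [← map_mul]
      rcases husq x with hx | hx <;> rw [hx]
      · exact Or.inl (map_one ψ)
      · exact Or.inr (by rw [map_neg, map_one])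
    · let t : S := conjIn S g (fun n hn => hS.conj_mem n hn g) s
      have hψs : ∀ (α : AdjoinI k) b, ψ (α • b) = α • ψ b := fun α b => by
        rw [Algebra.smul_def, map_mul, hψc, ← Algebra.smul_def]
      have h1 := hγ t (c x)
      rw [hη x, h.smul_smul_eq, hconjf g s t rfl, ← hψ s t rfl, hγ, hψs, smul_smul,
        smul_smul] at h1
      have h2 : ψ (u x) ≠ 0 := fun h0 => hu0 x (ψ.injective (h0.trans (map_zero ψ).symm))
      have h3 : f s (η x) * γ s x = γ t (c x) * η x := smul_left_injective (AdjoinI k) h2 h1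
      change (γ t (c x) : AdjoinI k) = _
      rw [← mul_div_assoc, eq_div_iff (η x).ne_zero, ← h3, mul_comm]
  -- The Galois group has a single nontrivial element; sending it to `g₀` is multiplicative because
  -- `g₀ * g₀ = 1`.
  let sec : (AdjoinI k ≃ₐ[k] AdjoinI k) →* S :=
    { toFun := fun τ => if τ = 1 then 1 else g₀
      map_one' := if_pos rfl
      map_mul' := fun τ τ' => by
        have hff : f g₀ * f g₀ = 1 := by rw [← map_mul, hg₀g₀, map_one]
        by_cases h1 : τ = 1
        · simp [h1]
        · by_cases h2 : τ' = 1
          · simp [h2]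
          · have h3 : τ * τ' = 1 := by
              rw [AdjoinI.eq_of_ne_one h1 hfg₀, AdjoinI.eq_of_ne_one h2 hfg₀, hff]
            rw [if_pos h3, if_neg h1, if_neg h2, hg₀g₀] }
  have hsec : ∀ τ, sec τ = 1 ∧ τ = 1 ∨ sec τ = g₀ ∧ τ = f g₀ := fun τ => by
    by_cases h1 : τ = 1
    · exact Or.inl ⟨if_pos h1, h1⟩
    · exact Or.inr ⟨if_neg h1, AdjoinI.eq_of_ne_one h1 hfg₀⟩
  have hγoneleft : ∀ x, γ 1 x = 1 := fun x => mul_eq_left (a := γ 1 x).mp (by rw [← hγl, mul_one])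
  have hγoneright : ∀ s, γ s 1 = 1 := fun s => mul_eq_left (a := γ s 1).mp (by rw [← hγr, mul_one])
  have hN2 : ∀ x : N, x ^ 2 = 1 := fun x => by rw [sq, hNsq]
  let D : SemiRealTorsorDatum k G :=
    { S := S
      N := N
      N_le := hNS
      conj_mem := fun g _ x hx => hNnormal.conj_mem x hx g
      isGalois := inferInstance
      toGal := f
      toGal_surjective := h.surjective
      toGal_ker := by
        ext s
        rw [Subgroup.mem_subgroupOf, MonoidHom.mem_ker]
        exact ⟨fun hs => ⟨s, hs, rfl⟩, fun hs => hjf ⟨s, hs⟩⟩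
      not_char_dvd := by
        rw [ringChar.eq_zero, zero_dvd_iff]
        exact Nat.card_pos.ne'
      σ := σ
      nondegenerate := h.isNondegenerate hj hr hjf hu0 hu hσ hNcomm
      γ := γ
      γ_one_left := hγoneleft
      γ_one_right := hγoneright
      γ_mul_right := fun g x y => by
        rw [hconjS g g.2, hconjS g g.2, hσfix, hγr, Units.val_mul, mul_assoc]
      γ_mul_left := fun g t x => by
        rw [hconjS t t.2, hγfix, hγl, Units.val_mul, mul_comm]
      γ_eq_inner := fun x y => (hγalt x y).trans (σ.inner_eq_alt hNcomm x y).symm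
      S_comm := fun s hs t ht => congrArg Subtype.val (hcomm ⟨s, hs⟩ ⟨t, ht⟩)
      sec := sec
      toGal_sec := fun τ => by
        rcases hsec τ with ⟨h1, h2⟩ | ⟨h1, h2⟩
        · rw [h1, h2, map_one]
        · rw [h1, h2]
      exists_primitiveRoot := exists_isPrimitiveRoot_exponent hN2
      σ_mem := fun x y => Units.mem_range_map_algebraMap_of_sq_eq_one k (hσ2 x y)
      γ_mem := fun s x => Units.mem_range_map_algebraMap_of_sq_eq_one k (hγ2 s x)
      γ_pairing_left := hγl
      γ_pairing_right := hγr
      γ_sec := fun τ x => by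
        rcases hsec τ with ⟨h1, -⟩ | ⟨h1, -⟩
        · rw [h1, hγoneleft]
        · rw [h1]
          exact Units.ext (hcancel (x := x) (by rw [← hγ, hgu, Units.val_one, one_smul]))
      γ_alt := hγalt
      N_normal := hNnormal
      S_normal := hS
      cohomologous := fun g => by
        obtain ⟨η, -, hη1, hησ, hηγ⟩ := hcoh g
        refine ⟨η, fun x => Subgroup.mem_top _, hη1, hησ, fun s x => ?_⟩
        rw [GaloisDatum.conjS, hconjS s s.2]
        exact hηγ s x
      isPGroup := fun x => ⟨1, by rw [pow_one, hN2]⟩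
      σ_mem_two := fun x y => Units.mem_zpowers_neg_one (hσ2 x y)
      cohomologous_four := fun g => by
        obtain ⟨η, hη4, hη1, hησ, hηγ⟩ := hcoh g
        refine ⟨η, hη4, hη1, hησ, fun s x => ?_⟩
        rw [GaloisDatum.conjS, hconjS s s.2]
        exact hηγ s x }
  refine ⟨D, ?_, fun x hx y hy => congrArg Subtype.val (hNcomm ⟨x, hx⟩ ⟨y, hy⟩),
    fun x hx => congrArg Subtype.val (hN2 ⟨x, hx⟩)⟩
  let : MulSemiringAction D.toGaloisDatum.S B := ‹MulSemiringAction S B›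
  have : SMulCommClass D.toGaloisDatum.S k B := ‹SMulCommClass S k B›
  have hD : IsCentralGalois (B := B) D.toGaloisDatum.toGal :=
    ⟨h.isGaloisAlgebra, h.isSimpleRing, h.center, h.smul_algebraMap⟩
  refine D.toGaloisDatum.isomorphic_ind hD u hu0 hu hu1 hσ fun s x => ?_
  rw [GaloisDatum.conjS, hconjS s s.2]
  exact hγ s x

end SemiReal

end

/-! ### The theorem, by the two possible centers of the simple quotient -/

theorem mainTheorem4 {k G A : Type*} [Field k] [IsRealClosed k] [Group G] [Finite G]
    [Ring A] [Algebra k A] [MulSemiringAction G A] [SMulCommClass G k A]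
    (hA : IsGaloisAlgebra k G A)
    (hcard : Nat.card (equivariantAut k G A) = Nat.card G) :
    (∃ D : SemiRealTorsorDatum k G,
      GAlgIsomorphic k G A D.toGaloisDatum.Ind ∧ IsElementaryAbelianTwo D.N) ∨
    (∃ D : RealTorsorDatum k G,
      GAlgIsomorphic k G A D.toGaloisDatum.Ind ∧ IsElementaryAbelianTwo D.N) := by
  have := hA.nontrivial
  have := hA.finiteDimensional
  have : IsNoetherianRing A := isNoetherian_of_tower k inferInstance
  obtain ⟨M, hM⟩ := exists_isMaximalTwoSided A
  have := hM.isTwoSided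
  have := hM.isSimpleRing_quotient
  have hB := hA.quotient hM
  rcases center_eq_or_eq_adjoinI k (A ⧸ M) with hc | ⟨θ, hc, hθ⟩
  · right
    open scoped Pointwise in
    obtain ⟨f, hf⟩ := exists_gal_of_center (k := k) (Γ := MulAction.stabilizer G (M : Set A)) hc
    have h : IsCentralGalois (B := A ⧸ M) f := ⟨hB, this, hc, hf⟩
    obtain ⟨hle, hS, hψ⟩ := hA.stabilizer_of_card_equivariantAut hM hcard h.finite_equivariantAut
      h.card_equivariantAut_le
    obtain ⟨D, hD⟩ := exists_realTorsorDatum h hS hle hψ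
    exact ⟨D, (hA.isomorphic_inducedAlgebra hM).trans hD, D.elementary⟩
  · left
    let : Algebra (AdjoinI k) (A ⧸ M) := θ.toRingHom.toAlgebra' hθ
    have : IsScalarTower k (AdjoinI k) (A ⧸ M) :=
      .of_algebraMap_eq fun a => (θ.commutes a).symm
    open scoped Pointwise in
    obtain ⟨f, hf⟩ := exists_gal_of_center (k := k) (K := AdjoinI k)
      (Γ := MulAction.stabilizer G (M : Set A)) hc
    have h : IsCentralGalois (B := A ⧸ M) f := ⟨hB, ‹_›, hc, hf⟩
    obtain ⟨hle, hS, hψ⟩ := hA.stabilizer_of_card_equivariantAut hM hcard h.finite_equivariantAut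
      h.card_equivariantAut_le
    obtain ⟨D, hD, hN⟩ := exists_semiRealTorsorDatum h hS hle hψ
    exact ⟨D, (hA.isomorphic_inducedAlgebra hM).trans hD, hN⟩
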